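/- **Minimax Kullback–Leibler prediction risk over Sobolev ellipsoids.** For $\theta=(\theta_1,\theta_2,\dots)$ and integers $n,m\ge 1$, let $X\sim N\big((\theta_1,\dots,\theta_n),\tfrac1n I_n\big)$ and $\tilde X\sim N\big((\theta_1,\dots,\theta_n),\tfrac1m I_n\big)$ be independent. A predictive density is a jointly measurable function $\hat p(\tilde x\mid x)\ge 0$ on $\mathbb R^n\times\mathbb R^n$ with $\int\hat p(\tilde x\mid x)\,d\tilde x=1$ for every $x$; its risk is $$R(\theta,\hat p)=\frac1m\,E\log\frac{p(\tilde X\mid\theta)}{\hat p(\tilde X\mid X)}\in[0,\infty].$$ For a set $\Theta$ of sequences let $R(\Theta)=\inf_{\hat p}\sup_{\theta\in\Theta}R(\theta,\hat p)$, the infimum being over all predictive densities, and let $R_L(\Theta)=\inf_S\sup_{\theta\in\Theta}R(\theta,\hat p_S)$, where $S=\operatorname{diag}(s_1,\dots,s_n)$ ranges over all diagonal matrices with $s_i\ge 0$ and $$\hat p_S(\tilde x\mid x)=\frac{\int p(x\mid\vartheta)\,p(\tilde x\mid\vartheta)\,\pi_S(d\vartheta)}{\int p(x\mid\vartheta)\,\pi_S(d\vartheta)},\qquad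 \pi_S=N(0,S),$$ is the Bayes predictive density under the (possibly degenerate) Gaussian prior $N(0,S)$ on $\mathbb R^n$. Let $C>0$, $\alpha>0$, $a_{2i}=a_{2i-1}=(2i)^\alpha$ for $i\ge1$, and $\Theta(C,\alpha)=\{\theta:\sum_{i=1}^\infty a_i^2\theta_i^2\le C\}$. Take $m=n$. Put $$\Sigma_\alpha=\sum_{k=0}^\infty\frac{2\sqrt2\,(-1)^k(2k)!}{(1-2k)\,(k!)^2\,32^k}\cdot\frac1{(2k+1)\alpha+1},$$ $$M=\left[\frac{4C}{\Sigma_\alpha-\frac{3}{2\alpha+1}}\right]^{1/(2\alpha+1)},\qquad K=1+\frac1{2(2\alpha+1)}-\frac12\,\Sigma_\alpha .$$ Then the series $\Sigma_\alpha$ converges absolutely, $\Sigma_\alpha>\frac3{2\alpha+1}$ and $K>0$ (so $K$ and $M$ are well defined and positive), the limits below exist, are positive and finite, and $$\lim_{n\to\infty}n^{2\alpha/(2\alpha+1)}R(\Theta(C,\alpha))=\lim_{n\to\infty}n^{2\alpha/(2\alpha+1)}R_L(\Theta(C,\alpha))\in\left(\tfrac14KM,\ \tfrac12KM\right).$$ In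 particular the minimax risk converges to zero at the rate $n^{-2\alpha/(2\alpha+1)}$. -/

import Mathlib

open MeasureTheory ProbabilityTheory Filter Topology
open scoped ENNReal NNReal

noncomputable section

namespace KLPrediction

/-- The law `N(θ, v I_n)` on `ℝⁿ` (product of one-dimensional Gaussians with variance `v`). -/
def gaussianLaw {n : ℕ} (θ : Fin n → ℝ) (v : ℝ≥0) : Measure (Fin n → ℝ) :=
  Measure.pi fun i => gaussianReal (θ i) v

/-- The Lebesgue density at `x` of `N(θ, v I_n)`. -/
def gaussianDensity {n : ℕ} (θ : Fin n → ℝ) (v : ℝ≥0) (x : Fin n → ℝ) : ℝ :=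
  ∏ i, gaussianPDFReal (θ i) v (x i)

/-- `p x y` is a predictive density `p̂(y | x)` on `ℝⁿ`: jointly measurable, nonnegative, and a
probability density in `y` for every observed value `x`. -/
structure IsPredictiveDensity {n : ℕ} (p : (Fin n → ℝ) → (Fin n → ℝ) → ℝ) : Prop where
  measurable : Measurable (Function.uncurry p)
  nonneg : ∀ x y, 0 ≤ p x y
  lintegral_eq_one : ∀ x, ∫⁻ y, ENNReal.ofReal (p x y) = 1

/-- The average Kullback-Leibler risk
`R(θ, p̂) = (1/m) E log (p(X' | θ) / p̂(X' | X))`, with `X ~ N(θ, I_n / n)` and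
`X' ~ N(θ, I_n / m)` independent: the mean over `X` of the Kullback-Leibler divergence of the
predictive distribution `p̂(· | X)` from the law of `X'`, divided by `m`. -/
def klRisk {n : ℕ} (m : ℕ) (θ : Fin n → ℝ) (p : (Fin n → ℝ) → (Fin n → ℝ) → ℝ) : ℝ≥0∞ :=
  (m : ℝ≥0∞)⁻¹ *
    ∫⁻ x, InformationTheory.klDiv (gaussianLaw θ (1 / (m : ℝ≥0)))
        (volume.withDensity fun y => ENNReal.ofReal (p x y))
      ∂(gaussianLaw θ (1 / (n : ℝ≥0)))

/-- The vector of the first `n` coefficients of a sequence. -/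
def firstCoords (n : ℕ) (θ : ℕ → ℝ) : Fin n → ℝ := fun i => θ i

/-- The minimax risk over all predictive densities, for a parameter set `Θ` of sequences. -/
def minimaxRisk (n m : ℕ) (Θ : Set (ℕ → ℝ)) : ℝ≥0∞ :=
  ⨅ (p : (Fin n → ℝ) → (Fin n → ℝ) → ℝ) (_ : IsPredictiveDensity p),
    ⨆ θ ∈ Θ, klRisk m (firstCoords n θ) p

/-- The Gaussian prior `N(0, diag(s_1, …, s_n))`, with `s_i ≥ 0` (a coordinate with `s_i = 0` is
a point mass at zero). -/
def gaussianPrior {n : ℕ} (s : Fin n → ℝ≥0) : Measure (Fin n → ℝ) :=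
  Measure.pi fun i => gaussianReal 0 (s i)

/-- The "linear" predictive density `p̂_S`: the Bayes predictive density under the Gaussian prior
with covariance `S = diag(s)`. -/
def linearPredictiveDensity {n : ℕ} (m : ℕ) (s : Fin n → ℝ≥0) (x y : Fin n → ℝ) : ℝ :=
  (∫ θ, gaussianDensity θ (1 / (n : ℝ≥0)) x * gaussianDensity θ (1 / (m : ℝ≥0)) y
      ∂(gaussianPrior s)) /
    ∫ θ, gaussianDensity θ (1 / (n : ℝ≥0)) x ∂(gaussianPrior s)

/-- The linear minimax risk. -/
def linearMinimaxRisk (n m : ℕ) (Θ : Set (ℕ → ℝ)) : ℝ≥0∞ :=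
  ⨅ s : Fin n → ℝ≥0, ⨆ θ ∈ Θ, klRisk m (firstCoords n θ) (linearPredictiveDensity m s)

/-- The weights `a_{2i-1} = a_{2i} = (2i)^α`, for indices `k ≥ 1`. -/
def sobolevWeight (α : ℝ) (k : ℕ) : ℝ := ((2 * ((k + 1) / 2) : ℕ) : ℝ) ^ α

/-- The Sobolev ellipsoid `Θ(C, α) = {θ : ∑_{k ≥ 1} a_k² θ_k² ≤ C}`. Sequences are indexed from
zero: `θ i` is the `(i + 1)`-st coefficient. -/
def sobolevEllipsoid (C α : ℝ) : Set (ℕ → ℝ) :=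
  {θ | Summable (fun i => sobolevWeight α (i + 1) ^ 2 * θ i ^ 2) ∧
    ∑' i, sobolevWeight α (i + 1) ^ 2 * θ i ^ 2 ≤ C}

/-- The `k`-th term of the series in the constants `K` and `M`. -/
def seriesTerm (α : ℝ) (k : ℕ) : ℝ :=
  (2 * √2 * (-1) ^ k * ((2 * k).factorial : ℝ)) /
      ((1 - 2 * (k : ℝ)) * (k.factorial : ℝ) ^ 2 * 32 ^ k) *
    (1 / ((2 * (k : ℝ) + 1) * α + 1))

/-- The constant `M`. -/
def constM (C α : ℝ) : ℝ :=
  (4 * C / ((∑' k, seriesTerm α k) - 3 / (2 * α + 1))) ^ (1 / (2 * α + 1))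

/-- The constant `K`. -/
def constK (α : ℝ) : ℝ :=
  1 + 1 / (2 * (2 * α + 1)) - 1 / 2 * ∑' k, seriesTerm α k

end KLPrediction

end

/-!
The risk of the predictive density under the Gaussian prior `N(0, diag s)` is explicit: coordinate
`i` contributes to `n` times the risk an affine function `coordRisk w t` of `t = n * θ i ^ 2`, where
`w = n s / (1 + n s)` is the shrinkage factor (`klRisk_linearPredictiveDensity`). At `t = n s` it is
`log (1 + w) / 2`, so that `∑ log (1 + w i) / 2` is `n` times the Bayes risk. As a function of
`s` this is concave, and `coordRisk` is its tangent. Maximizing it over all `s` in the ellipsoid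
gives a saddle point: at the maximizer `s` the slopes of `coordRisk` are proportional to `a_i ^ 2`
on the coordinates with `0 < s i`, and are at most this multiple of `a_i ^ 2` on the others.
With `x = a_i ^ (1/α) / T`, for a cut-off frequency `T`, the optimal shrinkage factor is
`shrinkProfile α x`, the solution of `(1 - w) ^ 2 = x ^ (2 α) (1 + w)`.

*Upper bound.* `linearMinimaxRisk_le` bounds the risk of this prior on the ellipsoid.

*Lower bound.* The inequality `log f ≤ f` gives `klDiv μ ν ≤ klDiv μ (f ν) + ∫ f dμ`
(`klDiv_le_klDiv_withDensity_add_lintegral`). It is applied to the law `μ` of the future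
observation, the Bayes predictive law `ν`, and an arbitrary predictive density `f ν`. Since `f` has
mean one under the joint law of parameter and observations
(`lintegral_div_linearPredictiveDensity`), the part over a set `D` of parameters of the Bayes risk,
multiplied by `n`, exceeds `n` times the maximal risk over `D` by at most one, even if the prior
charges the complement of `D` (`setLIntegral_klRisk_linearPredictiveDensity_le`). The prior is
scaled so that the mean of `∑ a_i ^ 2 θ i ^ 2` tends to `r C` with `r < 1`. Its part outside of the
ellipsoid is then controlled by the variance of this form (`le_minimaxRisk`): in units of `1 / n`
the cost is bounded, while the Bayes risk grows like `T`.

*Limit.* Sums over the coordinates are Riemann sums for integrals of the profile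
(`tendsto_sum_frequency`), which leads to the limit `limitRisk`. The binomial series of
`√(1 + x ^ (2 α) / 8)` evaluates the budget integral and `∫ w` as the constants behind `M` and `K`,
and `w / 2 < log (1 + w) < w` on `0 < w < 1` gives the two bounds on the limit.
-/

namespace KLPrediction

/-! ### Products of Gaussian laws -/

/-- A product of laws on `ℝ` with integrable densities has the product density. -/
theorem pi_withDensity_ofReal {ι : Type*} [Fintype ι] (f : ι → ℝ → ℝ)
    (hf0 : ∀ i x, 0 ≤ f i x) (hfi : ∀ i, Integrable (f i)) :
    Measure.pi (fun i => volume.withDensity fun x => ENNReal.ofReal (f i x)) =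
      (volume : Measure (ι → ℝ)).withDensity fun x => ENNReal.ofReal (∏ i, f i (x i)) := by
  refine Measure.pi_eq fun s hs => ?_
  have hbox : MeasurableSet (Set.univ.pi s) := MeasurableSet.univ_pi hs
  rw [withDensity_apply _ hbox, volume_pi, Measure.restrict_pi_pi,
    ← ofReal_integral_eq_lintegral_ofReal, integral_fintype_prod_eq_prod,
    ENNReal.ofReal_prod_of_nonneg]
  · refine Finset.prod_congr rfl fun i _ => ?_
    rw [withDensity_apply _ (hs i), ofReal_integral_eq_lintegral_ofReal (hfi i).restrict
      (ae_of_all _ (hf0 i))]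
  · exact fun i _ => integral_nonneg (hf0 i)
  · exact Integrable.fintype_prod_dep fun i => (hfi i).restrict
  · exact ae_of_all _ fun x => Finset.prod_nonneg fun i _ => hf0 i _

theorem pi_gaussianReal_eq_withDensity {ι : Type*} [Fintype ι] (μ : ι → ℝ) (v : ι → ℝ≥0)
    (hv : ∀ i, v i ≠ 0) :
    Measure.pi (fun i => gaussianReal (μ i) (v i)) =
      volume.withDensity fun x => ENNReal.ofReal (∏ i, gaussianPDFReal (μ i) (v i) (x i)) := by
  rw [← pi_withDensity_ofReal (fun i => gaussianPDFReal (μ i) (v i))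
    (fun i => gaussianPDFReal_nonneg _ _) (fun i => integrable_gaussianPDFReal _ _)]
  congr with i : 1
  rw [gaussianReal_of_var_ne_zero _ (hv i)]
  rfl

theorem log_gaussianPDFReal_div (μ μ' : ℝ) {v v' : ℝ≥0} (hv : v ≠ 0) (hv' : v' ≠ 0) (y : ℝ) :
    Real.log (gaussianPDFReal μ v y / gaussianPDFReal μ' v' y) =
      1 / 2 * (Real.log (v' / v) - (y - μ) ^ 2 / v + (y - μ') ^ 2 / v') := by
  have h1 : (0 : ℝ) < v := by positivity
  have h2 : (0 : ℝ) < v' := by positivity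
  have hpi := Real.pi_pos
  have hl : ∀ t : ℝ, 0 < t → Real.log (2 * Real.pi * t) = Real.log (2 * Real.pi) + Real.log t :=
    fun t ht => Real.log_mul (by positivity) ht.ne'
  rw [Real.log_div (gaussianPDFReal_pos _ _ _ hv).ne' (gaussianPDFReal_pos _ _ _ hv').ne',
    gaussianPDFReal, gaussianPDFReal, Real.log_mul (by positivity) (by positivity),
    Real.log_mul (by positivity) (by positivity), Real.log_exp, Real.log_exp, Real.log_inv,
    Real.log_inv, Real.log_sqrt (by positivity), Real.log_sqrt (by positivity),
    hl _ h1, hl _ h2, Real.log_div (by positivity) (by positivity)]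
  field_simp
  ring

theorem integrable_sq_gaussianReal (μ : ℝ) (v : ℝ≥0) :
    Integrable (fun x => x ^ 2) (gaussianReal μ v) := by
  simpa using (memLp_id_gaussianReal (μ := μ) (v := v) 2).integrable_sq

theorem integral_sq_gaussianReal (μ : ℝ) (v : ℝ≥0) :
    ∫ x, x ^ 2 ∂gaussianReal μ v = v + μ ^ 2 := by
  have h := variance_eq_sub (memLp_id_gaussianReal (μ := μ) (v := v) 2)
  rw [variance_id_gaussianReal] at h
  simp only [Pi.pow_apply, id_eq, integral_id_gaussianReal] at h
  linarith

theorem integrable_sq_affine_gaussianReal (μ : ℝ) (v : ℝ≥0) (a b : ℝ) :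
    Integrable (fun x => (a - b * x) ^ 2) (gaussianReal μ v) := by
  have h1 : Integrable (fun x : ℝ => x) (gaussianReal μ v) :=
    (memLp_id_gaussianReal (μ := μ) (v := v) 1).integrable le_rfl
  have : (fun x : ℝ => (a - b * x) ^ 2) = fun x => a ^ 2 - 2 * a * b * x + b ^ 2 * x ^ 2 := by
    ext; ring
  rw [this]
  exact ((integrable_const _).sub (h1.const_mul _)).add
    ((integrable_sq_gaussianReal μ v).const_mul _)

theorem integral_sq_affine_gaussianReal (μ : ℝ) (v : ℝ≥0) (a b : ℝ) :
    ∫ x, (a - b * x) ^ 2 ∂gaussianReal μ v = (a - b * μ) ^ 2 + b ^ 2 * v := by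
  have h1 : Integrable (fun x : ℝ => x) (gaussianReal μ v) :=
    (memLp_id_gaussianReal (μ := μ) (v := v) 1).integrable le_rfl
  have : (fun x : ℝ => (a - b * x) ^ 2) = fun x => a ^ 2 - 2 * a * b * x + b ^ 2 * x ^ 2 := by
    ext; ring
  have h2 : Integrable (fun x : ℝ => a ^ 2 - 2 * a * b * x) (gaussianReal μ v) :=
    (integrable_const _).sub (h1.const_mul _)
  rw [this, integral_add h2 ((integrable_sq_gaussianReal μ v).const_mul _),
    integral_sub (integrable_const _) (h1.const_mul _), integral_const_mul, integral_const_mul,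
    integral_sq_gaussianReal, integral_id_gaussianReal]
  simp
  ring

theorem integrable_log_gaussianPDFReal_div (μ μ' : ℝ) {v v' : ℝ≥0} (hv : v ≠ 0) (hv' : v' ≠ 0) :
    Integrable (fun y => Real.log (gaussianPDFReal μ v y / gaussianPDFReal μ' v' y))
      (gaussianReal μ v) := by
  simp_rw [log_gaussianPDFReal_div μ μ' hv hv']
  have h (m : ℝ) := integrable_sq_affine_gaussianReal μ v m 1
  have h' (m : ℝ) : Integrable (fun x => (x - m) ^ 2) (gaussianReal μ v) := by
    convert! h m using 2
    ring
  exact (((integrable_const _).sub ((h' μ).div_const _)).add ((h' μ').div_const _)).const_mul _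

/-- The Kullback-Leibler divergence of one real Gaussian law from another, as an integral. -/
theorem integral_log_gaussianPDFReal_div (μ μ' : ℝ) {v v' : ℝ≥0} (hv : v ≠ 0) (hv' : v' ≠ 0) :
    ∫ y, Real.log (gaussianPDFReal μ v y / gaussianPDFReal μ' v' y) ∂gaussianReal μ v =
      1 / 2 * (Real.log (v' / v) - 1 + (v + (μ - μ') ^ 2) / v') := by
  have h1 : (0 : ℝ) < v := by positivity
  simp_rw [log_gaussianPDFReal_div μ μ' hv hv']
  have h (m : ℝ) : Integrable (fun x => (x - m) ^ 2) (gaussianReal μ v) := by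
    convert! integrable_sq_affine_gaussianReal μ v m 1 using 2
    ring
  have e (m : ℝ) : ∫ x, (x - m) ^ 2 ∂gaussianReal μ v = v + (μ - m) ^ 2 := by
    have := integral_sq_affine_gaussianReal μ v m 1
    simp only [one_mul, one_pow] at this
    simp_rw [sub_sq_comm _ m, this]
    ring
  have h2 : Integrable (fun x => Real.log (v' / v) - (x - μ) ^ 2 / v) (gaussianReal μ v) :=
    (integrable_const _).sub ((h μ).div_const _)
  rw [integral_const_mul, integral_add h2 ((h μ').div_const _),
    integral_sub (integrable_const _) ((h μ).div_const _),
    integral_div, integral_div, e, e]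
  simp only [integral_const, probReal_univ, smul_eq_mul, one_mul, sub_self]
  rw [zero_pow two_ne_zero, add_zero, div_self h1.ne']

/-! ### Kullback-Leibler divergence and densities -/

theorem withDensity_ofReal_eq {Ω : Type*} [MeasurableSpace Ω] {ν : Measure Ω} {f g : Ω → ℝ}
    (hf : Measurable f) (hg : Measurable g) (hg0 : ∀ x, 0 < g x) :
    ν.withDensity (fun x => ENNReal.ofReal (f x)) =
      (ν.withDensity fun x => ENNReal.ofReal (g x)).withDensity
        fun x => ENNReal.ofReal (f x / g x) := by
  rw [← withDensity_mul _ (by fun_prop) (by fun_prop)]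
  congr with x : 1
  rw [Pi.mul_apply, ← ENNReal.ofReal_mul (hg0 x).le, mul_div_cancel₀ _ (hg0 x).ne']

theorem llr_withDensity_ofReal {Ω : Type*} [MeasurableSpace Ω] {ν : Measure Ω} [SigmaFinite ν]
    {f g : Ω → ℝ} (hf : Measurable f) (hg : Measurable g) (hf0 : ∀ x, 0 < f x)
    (hg0 : ∀ x, 0 < g x) :
    llr (ν.withDensity fun x => ENNReal.ofReal (f x)) (ν.withDensity fun x => ENNReal.ofReal (g x))
      =ᵐ[ν.withDensity fun x => ENNReal.ofReal (f x)] fun x => Real.log (f x / g x) := by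
  rw [withDensity_ofReal_eq hf hg hg0]
  refine (withDensity_absolutelyContinuous _ _).ae_le ?_
  filter_upwards [Measure.rnDeriv_withDensity (ν.withDensity fun x => ENNReal.ofReal (g x))
    (f := fun x => ENNReal.ofReal (f x / g x)) (by fun_prop)] with x hx
  rw [llr_def]
  simp only
  rw [hx, ENNReal.toReal_ofReal (div_pos (hf0 x) (hg0 x)).le]

/-- Replacing the reference law `ν` of `klDiv μ ν` by `ν.withDensity f` lowers the divergence by
at most `∫ f dμ`, because `log f ≤ f`. -/
theorem klDiv_le_klDiv_withDensity_add_lintegral {Ω : Type*} [MeasurableSpace Ω] {μ ν : Measure Ω}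
    [IsProbabilityMeasure μ] [IsProbabilityMeasure ν] {f : Ω → ℝ≥0∞} (hf : Measurable f)
    [IsProbabilityMeasure (ν.withDensity f)] (hμν : μ ≪ ν) (hint : Integrable (llr μ ν) μ) :
    InformationTheory.klDiv μ ν ≤
      InformationTheory.klDiv μ (ν.withDensity f) + ∫⁻ x, f x ∂μ := by
  by_cases h1 : InformationTheory.klDiv μ (ν.withDensity f) = ∞
  · simp [h1]
  by_cases h2 : ∫⁻ x, f x ∂μ = ∞
  · simp [h2]
  obtain ⟨hac, hi⟩ := InformationTheory.klDiv_ne_top_iff.1 h1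
  have hfi : Integrable (fun x => (f x).toReal) μ :=
    integrable_toReal_of_lintegral_ne_top hf.aemeasurable h2
  have hle : ∀ᵐ x ∂μ, llr μ ν x ≤ llr μ (ν.withDensity f) x + (f x).toReal := by
    have e1 := hμν.ae_le (Measure.rnDeriv_mul_rnDeriv (κ := ν) hac)
    have e2 := hμν.ae_le (Measure.rnDeriv_withDensity ν hf)
    have e3 := Measure.rnDeriv_pos hμν
    have e4 := hμν.ae_le (Measure.rnDeriv_lt_top μ ν)
    filter_upwards [e1, e2, e3, e4] with x h1 h2 h3 h4
    have hpos : 0 < (μ.rnDeriv ν x).toReal := ENNReal.toReal_pos h3.ne' h4.ne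
    rw [← h1, Pi.mul_apply, ENNReal.toReal_mul, h2] at hpos
    have hp2 : 0 < (f x).toReal :=
      lt_of_le_of_ne ENNReal.toReal_nonneg fun h => by simp [← h] at hpos
    have hp1 := pos_of_mul_pos_left hpos hp2.le
    rw [llr_def, llr_def]
    simp only
    rw [← h1, Pi.mul_apply, ENNReal.toReal_mul, h2, Real.log_mul hp1.ne' hp2.ne']
    linarith [Real.log_le_self hp2.le]
  have hI : ∫ x, llr μ ν x ∂μ ≤ ∫ x, llr μ (ν.withDensity f) x ∂μ + ∫ x, (f x).toReal ∂μ := by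
    rw [← integral_add hi hfi]
    exact integral_mono_ae hint (hi.add hfi) hle
  have hfin := InformationTheory.klDiv_ne_top hμν hint
  rwa [← ENNReal.toReal_le_toReal hfin (by simp [h1, h2]), ENNReal.toReal_add h1 h2,
    InformationTheory.toReal_klDiv_of_measure_eq hμν (by simp),
    InformationTheory.toReal_klDiv_of_measure_eq hac (by simp),
    ← integral_toReal hf.aemeasurable (ae_lt_top hf h2)]

/-! ### Predictive densities under a Gaussian prior -/

/-- Completing the square: the joint density of a Gaussian parameter and an observation, written
as the marginal density times the posterior density. -/
theorem gaussianPDFReal_mul_gaussianPDFReal (μ θ x : ℝ) {s v : ℝ≥0} (hs : s ≠ 0) (hv : v ≠ 0) :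
    gaussianPDFReal μ s θ * gaussianPDFReal θ v x =
      gaussianPDFReal μ (s + v) x *
        gaussianPDFReal ((v * μ + s * x) / (s + v)) (s * v / (s + v)) θ := by
  have h1 : (0 : ℝ) < s := by positivity
  have h2 : (0 : ℝ) < v := by positivity
  have hpi := Real.pi_pos
  simp only [gaussianPDFReal, NNReal.coe_add, NNReal.coe_div, NNReal.coe_mul]
  have e1 : (√(2 * Real.pi * s))⁻¹ * (√(2 * Real.pi * v))⁻¹ =
      (√(2 * Real.pi * (s + v)))⁻¹ * (√(2 * Real.pi * (s * v / (s + v))))⁻¹ := by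
    rw [← mul_inv, ← mul_inv, ← Real.sqrt_mul (by positivity), ← Real.sqrt_mul (by positivity)]
    congr 2
    field_simp
  have e2 : -(θ - μ) ^ 2 / (2 * s) + -(x - θ) ^ 2 / (2 * v) =
      -(x - μ) ^ 2 / (2 * (s + v)) +
        -(θ - (v * μ + s * x) / (s + v)) ^ 2 / (2 * (s * v / (s + v))) := by
    field_simp
    ring
  rw [mul_mul_mul_comm, mul_mul_mul_comm _ (Real.exp _), e1, ← Real.exp_add, ← Real.exp_add, e2]

theorem integral_gaussianPDFReal_gaussianReal (μ x : ℝ) (s : ℝ≥0) {v : ℝ≥0} (hv : v ≠ 0) :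
    ∫ θ, gaussianPDFReal θ v x ∂gaussianReal μ s = gaussianPDFReal μ (s + v) x := by
  rcases eq_or_ne s 0 with rfl | hs
  · simp
  · rw [integral_gaussianReal_eq_integral_smul hs]
    simp_rw [smul_eq_mul, gaussianPDFReal_mul_gaussianPDFReal μ _ x hs hv]
    rw [integral_const_mul, integral_gaussianPDFReal_eq_one, mul_one]
    positivity

/-- The factor by which the posterior mean shrinks an observation of variance `v` under the
prior `N(0, s)`. -/
noncomputable def shrinkFactor (v s : ℝ≥0) : ℝ≥0 := s / (s + v)

theorem integral_gaussianPDFReal_mul_gaussianReal (x y : ℝ) (s : ℝ≥0) {v : ℝ≥0} (hv : v ≠ 0) :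
    ∫ θ, gaussianPDFReal θ v x * gaussianPDFReal θ v y ∂gaussianReal 0 s =
      gaussianPDFReal 0 (s + v) x *
        gaussianPDFReal (shrinkFactor v s * x) (v * (1 + shrinkFactor v s)) y := by
  rcases eq_or_ne s 0 with rfl | hs
  · simp [shrinkFactor]
  · have hp : s * v / (s + v) ≠ 0 := by positivity
    rw [integral_gaussianReal_eq_integral_smul hs]
    simp_rw [smul_eq_mul, ← mul_assoc, gaussianPDFReal_mul_gaussianPDFReal 0 _ x hs hv, mul_assoc,
      gaussianPDFReal_mul_gaussianPDFReal _ _ y hp hv]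
    rw [integral_const_mul, integral_const_mul, integral_gaussianPDFReal_eq_one _ (by positivity),
      mul_one]
    congr 2
    · simp [shrinkFactor]
      ring
    · rw [shrinkFactor]
      field_simp
      ring

variable {n : ℕ}

theorem one_div_natCast_ne_zero (hn : n ≠ 0) : (1 / (n : ℝ≥0)) ≠ 0 := by positivity

theorem integral_gaussianDensity_gaussianPrior (hn : n ≠ 0) (s : Fin n → ℝ≥0) (x : Fin n → ℝ) :
    ∫ θ, gaussianDensity θ (1 / (n : ℝ≥0)) x ∂(gaussianPrior s) =
      ∏ i, gaussianPDFReal 0 (s i + 1 / (n : ℝ≥0)) (x i) := by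
  simp only [gaussianDensity, gaussianPrior]
  rw [integral_fintype_prod_eq_prod fun i θ => gaussianPDFReal θ (1 / (n : ℝ≥0)) (x i)]
  exact Finset.prod_congr rfl fun i _ =>
    integral_gaussianPDFReal_gaussianReal _ _ _ (one_div_natCast_ne_zero hn)

theorem integral_gaussianDensity_mul_gaussianPrior (hn : n ≠ 0) (s : Fin n → ℝ≥0)
    (x y : Fin n → ℝ) :
    ∫ θ, gaussianDensity θ (1 / (n : ℝ≥0)) x * gaussianDensity θ (1 / (n : ℝ≥0)) y
        ∂(gaussianPrior s) =
      (∏ i, gaussianPDFReal 0 (s i + 1 / (n : ℝ≥0)) (x i)) *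
        ∏ i, gaussianPDFReal (shrinkFactor (1 / (n : ℝ≥0)) (s i) * x i)
          (1 / (n : ℝ≥0) * (1 + shrinkFactor (1 / (n : ℝ≥0)) (s i))) (y i) := by
  simp only [gaussianDensity, gaussianPrior, ← Finset.prod_mul_distrib]
  rw [integral_fintype_prod_eq_prod fun i θ =>
    gaussianPDFReal θ (1 / (n : ℝ≥0)) (x i) * gaussianPDFReal θ (1 / (n : ℝ≥0)) (y i)]
  exact Finset.prod_congr rfl fun i _ =>
    integral_gaussianPDFReal_mul_gaussianReal _ _ _ (one_div_natCast_ne_zero hn)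

theorem prod_gaussianPDFReal_pos {ι : Type*} [Fintype ι] (μ : ι → ℝ) {v : ι → ℝ≥0}
    (hv : ∀ i, v i ≠ 0) (x : ι → ℝ) : 0 < ∏ i, gaussianPDFReal (μ i) (v i) (x i) :=
  Finset.prod_pos fun i _ => gaussianPDFReal_pos _ _ _ (hv i)

theorem linearPredictiveDensity_eq (hn : n ≠ 0) (s : Fin n → ℝ≥0) (x y : Fin n → ℝ) :
    linearPredictiveDensity n s x y =
      ∏ i, gaussianPDFReal (shrinkFactor (1 / (n : ℝ≥0)) (s i) * x i)
        (1 / (n : ℝ≥0) * (1 + shrinkFactor (1 / (n : ℝ≥0)) (s i))) (y i) := by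
  rw [linearPredictiveDensity, integral_gaussianDensity_mul_gaussianPrior hn,
    integral_gaussianDensity_gaussianPrior hn, mul_div_cancel_left₀]
  exact (prod_gaussianPDFReal_pos _ (fun i => by positivity) _).ne'

theorem linearPredictiveDensity_pos (hn : n ≠ 0) (s : Fin n → ℝ≥0) (x y : Fin n → ℝ) :
    0 < linearPredictiveDensity n s x y := by
  rw [linearPredictiveDensity_eq hn]
  exact prod_gaussianPDFReal_pos _ (fun i => by positivity) _

theorem measurable_linearPredictiveDensity (hn : n ≠ 0) (s : Fin n → ℝ≥0) :
    Measurable (Function.uncurry (linearPredictiveDensity n s)) := by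
  have : Function.uncurry (linearPredictiveDensity n s) = fun p : (Fin n → ℝ) × (Fin n → ℝ) =>
      ∏ i, gaussianPDFReal (shrinkFactor (1 / (n : ℝ≥0)) (s i) * p.1 i)
        (1 / (n : ℝ≥0) * (1 + shrinkFactor (1 / (n : ℝ≥0)) (s i))) (p.2 i) := by
    ext p
    exact linearPredictiveDensity_eq hn s p.1 p.2
  rw [this]
  refine Finset.measurable_prod _ fun i _ => ?_
  exact measurable_uncurry_gaussianPDFReal.comp
    (f := fun p : (Fin n → ℝ) × (Fin n → ℝ) => (shrinkFactor (1 / (n : ℝ≥0)) (s i) * p.1 i,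
        1 / (n : ℝ≥0) * (1 + shrinkFactor (1 / (n : ℝ≥0)) (s i)), p.2 i)) (by fun_prop)

/-- The predictive law under the prior `N(0, diag s)`, given the observation `x`. -/
theorem withDensity_linearPredictiveDensity (hn : n ≠ 0) (s : Fin n → ℝ≥0) (x : Fin n → ℝ) :
    (volume.withDensity fun y => ENNReal.ofReal (linearPredictiveDensity n s x y)) =
      Measure.pi fun i => gaussianReal (shrinkFactor (1 / (n : ℝ≥0)) (s i) * x i)
        (1 / (n : ℝ≥0) * (1 + shrinkFactor (1 / (n : ℝ≥0)) (s i))) := by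
  rw [pi_gaussianReal_eq_withDensity _ _ fun i => by positivity]
  simp_rw [linearPredictiveDensity_eq hn]

theorem isPredictiveDensity_linearPredictiveDensity (hn : n ≠ 0) (s : Fin n → ℝ≥0) :
    IsPredictiveDensity (linearPredictiveDensity n s) where
  measurable := measurable_linearPredictiveDensity hn s
  nonneg x y := (linearPredictiveDensity_pos hn s x y).le
  lintegral_eq_one x := by
    rw [← setLIntegral_univ, ← withDensity_apply _ MeasurableSet.univ,
      withDensity_linearPredictiveDensity hn, measure_univ]

theorem minimaxRisk_le_linearMinimaxRisk (hn : n ≠ 0) (Θ : Set (ℕ → ℝ)) :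
    minimaxRisk n n Θ ≤ linearMinimaxRisk n n Θ :=
  le_iInf fun s => iInf₂_le _ (isPredictiveDensity_linearPredictiveDensity hn s)

theorem gaussianLaw_eq_withDensity (θ : Fin n → ℝ) {v : ℝ≥0} (hv : v ≠ 0) :
    gaussianLaw θ v = volume.withDensity fun x => ENNReal.ofReal (gaussianDensity θ v x) :=
  pi_gaussianReal_eq_withDensity _ _ fun _ => hv

instance isProbabilityMeasure_gaussianLaw (θ : Fin n → ℝ) (v : ℝ≥0) :
    IsProbabilityMeasure (gaussianLaw θ v) := by
  unfold gaussianLaw; infer_instance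

instance isProbabilityMeasure_gaussianPrior (s : Fin n → ℝ≥0) :
    IsProbabilityMeasure (gaussianPrior s) := by
  unfold gaussianPrior; infer_instance

theorem gaussianDensity_pos (θ : Fin n → ℝ) {v : ℝ≥0} (hv : v ≠ 0) (x : Fin n → ℝ) :
    0 < gaussianDensity θ v x :=
  prod_gaussianPDFReal_pos _ (fun _ => hv) _

theorem measurable_uncurry_gaussianDensity (v : ℝ≥0) :
    Measurable (Function.uncurry fun θ x : Fin n → ℝ => gaussianDensity θ v x) := by
  change Measurable fun p : (Fin n → ℝ) × (Fin n → ℝ) => gaussianDensity p.1 v p.2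
  exact
  Finset.measurable_prod _ fun i _ => measurable_uncurry_gaussianPDFReal.comp
    (f := fun p : (Fin n → ℝ) × (Fin n → ℝ) => (p.1 i, v, p.2 i)) (by fun_prop)

/-! ### The risk of a Gaussian predictive density -/

/-- The log-likelihood ratio of Gaussian product laws is a sum over the coordinates, so that the
divergence reduces to integrals over `ℝ`. -/
theorem llr_pi_gaussianReal {ι : Type*} [Fintype ι] (μ μ' : ι → ℝ) {v v' : ι → ℝ≥0}
    (hv : ∀ i, v i ≠ 0) (hv' : ∀ i, v' i ≠ 0) :
    llr (Measure.pi fun i => gaussianReal (μ i) (v i))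
      (Measure.pi fun i => gaussianReal (μ' i) (v' i))
      =ᵐ[Measure.pi fun i => gaussianReal (μ i) (v i)] fun y =>
        ∑ i, Real.log (gaussianPDFReal (μ i) (v i) (y i) / gaussianPDFReal (μ' i) (v' i) (y i)) := by
  rw [pi_gaussianReal_eq_withDensity _ _ hv, pi_gaussianReal_eq_withDensity _ _ hv']
  refine (llr_withDensity_ofReal ?_ ?_ (prod_gaussianPDFReal_pos _ hv)
    (prod_gaussianPDFReal_pos _ hv')).trans (ae_of_all _ fun y => ?_)
  · fun_prop
  · fun_prop
  · simp only
    rw [← Finset.prod_div_distrib, Real.log_prod]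
    exact fun i _ => (div_pos (gaussianPDFReal_pos _ _ _ (hv i))
      (gaussianPDFReal_pos _ _ _ (hv' i))).ne'

theorem integrable_llr_pi_gaussianReal {ι : Type*} [Fintype ι] (μ μ' : ι → ℝ) {v v' : ι → ℝ≥0}
    (hv : ∀ i, v i ≠ 0) (hv' : ∀ i, v' i ≠ 0) :
    Integrable (llr (Measure.pi fun i => gaussianReal (μ i) (v i))
      (Measure.pi fun i => gaussianReal (μ' i) (v' i)))
      (Measure.pi fun i => gaussianReal (μ i) (v i)) := by
  rw [integrable_congr (llr_pi_gaussianReal μ μ' hv hv')]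
  refine integrable_finsetSum _ fun i _ => ?_
  exact integrable_comp_eval (μ := fun i => gaussianReal (μ i) (v i))
    (integrable_log_gaussianPDFReal_div _ _ (hv i) (hv' i))

theorem pi_gaussianReal_absolutelyContinuous {ι : Type*} [Fintype ι] (μ μ' : ι → ℝ)
    {v v' : ι → ℝ≥0} (hv : ∀ i, v i ≠ 0) (hv' : ∀ i, v' i ≠ 0) :
    (Measure.pi fun i => gaussianReal (μ i) (v i)) ≪
      Measure.pi fun i => gaussianReal (μ' i) (v' i) := by
  rw [pi_gaussianReal_eq_withDensity _ _ hv, pi_gaussianReal_eq_withDensity _ _ hv',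
    withDensity_ofReal_eq (f := fun x => ∏ i, gaussianPDFReal (μ i) (v i) (x i)) (by fun_prop)
      (by fun_prop) (prod_gaussianPDFReal_pos _ hv')]
  exact withDensity_absolutelyContinuous _ _

theorem integral_llr_pi_gaussianReal {ι : Type*} [Fintype ι] (μ μ' : ι → ℝ) {v v' : ι → ℝ≥0}
    (hv : ∀ i, v i ≠ 0) (hv' : ∀ i, v' i ≠ 0) :
    ∫ y, llr (Measure.pi fun i => gaussianReal (μ i) (v i))
        (Measure.pi fun i => gaussianReal (μ' i) (v' i)) y
        ∂(Measure.pi fun i => gaussianReal (μ i) (v i)) =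
      ∑ i, 1 / 2 * (Real.log (v' i / v i) - 1 + (v i + (μ i - μ' i) ^ 2) / v' i) := by
  have hi i := integrable_log_gaussianPDFReal_div (μ i) (μ' i) (hv i) (hv' i)
  rw [integral_congr_ae (llr_pi_gaussianReal μ μ' hv hv'), integral_finsetSum]
  · refine Finset.sum_congr rfl fun i _ => ?_
    rw [integral_comp_eval (μ := fun i => gaussianReal (μ i) (v i)) (hi i).aestronglyMeasurable,
      integral_log_gaussianPDFReal_div _ _ (hv i) (hv' i)]
  · exact fun i _ => integrable_comp_eval (μ := fun i => gaussianReal (μ i) (v i)) (hi i)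

theorem klDiv_pi_gaussianReal {ι : Type*} [Fintype ι] (μ μ' : ι → ℝ) {v v' : ι → ℝ≥0}
    (hv : ∀ i, v i ≠ 0) (hv' : ∀ i, v' i ≠ 0) :
    InformationTheory.klDiv (Measure.pi fun i => gaussianReal (μ i) (v i))
      (Measure.pi fun i => gaussianReal (μ' i) (v' i)) =
      ENNReal.ofReal (∑ i, 1 / 2 * (Real.log (v' i / v i) - 1 +
        (v i + (μ i - μ' i) ^ 2) / v' i)) := by
  rw [InformationTheory.klDiv_of_ac_of_integrable
    (pi_gaussianReal_absolutelyContinuous μ μ' hv hv')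
    (integrable_llr_pi_gaussianReal μ μ' hv hv'), probReal_univ, probReal_univ,
    add_sub_cancel_right, integral_llr_pi_gaussianReal μ μ' hv hv']

/-- The risk, in units of `1 / n`, that a coordinate with normalized squared mean `t = n θ²`
contributes to the predictive density with shrinkage factor `w`. -/
noncomputable def coordRisk (w t : ℝ) : ℝ :=
  1 / 2 * (Real.log (1 + w) - w * (1 - w) / (1 + w) + (1 - w) ^ 2 / (1 + w) * t)

/-- The Bayes predictive density is a product of the laws `N(w x, (1 + w) / n)`, with `w` the
shrinkage factor; the mean of `(θ - w x) ^ 2` over the observation makes the risk affine in `θ ^ 2`. -/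
theorem klRisk_linearPredictiveDensity (hn : n ≠ 0) (θ : Fin n → ℝ) (s : Fin n → ℝ≥0) :
    klRisk n θ (linearPredictiveDensity n s) =
      (n : ℝ≥0∞)⁻¹ * ENNReal.ofReal
        (∑ i, coordRisk (shrinkFactor (1 / (n : ℝ≥0)) (s i)) (n * θ i ^ 2)) := by
  set v : ℝ≥0 := 1 / (n : ℝ≥0) with hvdef
  have hv : v ≠ 0 := one_div_natCast_ne_zero hn
  have hv0 : (0 : ℝ) < v := by positivity
  have hnv : (n : ℝ) = 1 / v := by simp [hvdef]
  set w : Fin n → ℝ≥0 := fun i => shrinkFactor v (s i) with hw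
  have hv' : ∀ i, v * (1 + w i) ≠ 0 := fun i => by positivity
  set k : (Fin n → ℝ) → Fin n → ℝ := fun x i => 1 / 2 * (Real.log (((v * (1 + w i) : ℝ≥0) : ℝ) / v)
    - 1 + (v + (θ i - w i * x i) ^ 2) / ((v * (1 + w i) : ℝ≥0) : ℝ)) with hk
  have key : ∀ x, InformationTheory.klDiv (gaussianLaw θ v)
      (volume.withDensity fun y => ENNReal.ofReal (linearPredictiveDensity n s x y)) =
      ENNReal.ofReal (∑ i, k x i) := fun x => by
    rw [withDensity_linearPredictiveDensity hn, gaussianLaw,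
      klDiv_pi_gaussianReal _ _ (fun _ => hv) hv']
  have hint1 : ∀ i, Integrable (fun x : ℝ => 1 / 2 * (Real.log (((v * (1 + w i) : ℝ≥0) : ℝ) / v)
      - 1 + (v + (θ i - w i * x) ^ 2) / ((v * (1 + w i) : ℝ≥0) : ℝ))) (gaussianReal (θ i) v) :=
    fun i => ((integrable_const _).add (((integrable_const _).add
      (integrable_sq_affine_gaussianReal _ _ _ _)).div_const _)).const_mul _
  have hint : ∀ i, Integrable (fun x => k x i) (gaussianLaw θ v) := fun i =>
    integrable_comp_eval (μ := fun i => gaussianReal (θ i) v) (hint1 i)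
  have hnn : ∀ x, 0 ≤ ∑ i, k x i := fun x => by
    have h := InformationTheory.integral_llr_add_sub_measure_univ_nonneg
      (pi_gaussianReal_absolutelyContinuous θ (fun i => w i * x i) (fun _ => hv) hv')
      (integrable_llr_pi_gaussianReal _ _ (fun _ => hv) hv')
    rwa [probReal_univ, probReal_univ, add_sub_cancel_right,
      integral_llr_pi_gaussianReal _ _ (fun _ => hv) hv'] at h
  rw [klRisk]
  congr 1
  rw [← hvdef]
  simp_rw [key]
  rw [← ofReal_integral_eq_lintegral_ofReal (integrable_finsetSum _ fun i _ => hint i)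
    (ae_of_all _ hnn), integral_finsetSum _ fun i _ => hint i]
  congr 1
  refine Finset.sum_congr rfl fun i _ => ?_
  have hsq : Integrable (fun x => v + (θ i - w i * x) ^ 2) (gaussianReal (θ i) v) :=
    (integrable_const _).add (integrable_sq_affine_gaussianReal _ _ _ _)
  rw [hk, gaussianLaw]
  simp only
  rw [integral_comp_eval (μ := fun i => gaussianReal (θ i) v) (hint1 i).aestronglyMeasurable,
    integral_const_mul, integral_add (integrable_const _) (hsq.div_const _), integral_div,
    integral_add (integrable_const _) (integrable_sq_affine_gaussianReal _ _ _ _),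
    integral_sq_affine_gaussianReal, coordRisk, hnv]
  have hw0 : (0 : ℝ) ≤ w i := (w i).2
  simp only [integral_const, probReal_univ, smul_eq_mul, one_mul, NNReal.coe_mul, NNReal.coe_add,
    NNReal.coe_one]
  rw [mul_div_cancel_left₀ _ hv0.ne']
  change _ = 1 / 2 * (Real.log (1 + (w i : ℝ)) - w i * (1 - w i) / (1 + w i) +
    (1 - (w i : ℝ)) ^ 2 / (1 + w i) * _)
  field_simp
  ring

/-! ### Bayes risk bounds the risk of every predictive density -/

theorem lintegral_gaussianLaw (θ : Fin n → ℝ) {v : ℝ≥0} (hv : v ≠ 0) {f : (Fin n → ℝ) → ℝ≥0∞}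
    (hf : Measurable f) :
    ∫⁻ x, f x ∂gaussianLaw θ v = ∫⁻ x, ENNReal.ofReal (gaussianDensity θ v x) * f x := by
  have hm : Measurable fun x => gaussianDensity θ v x :=
    Measurable.of_uncurry_left (f := fun θ x : Fin n → ℝ => gaussianDensity θ v x)
      (measurable_uncurry_gaussianDensity v)
  rw [gaussianLaw_eq_withDensity θ hv,
    lintegral_withDensity_eq_lintegral_mul _ hm.ennreal_ofReal hf]
  simp only [Pi.mul_apply]

/-- The law of the observation and the future observation, with the parameter integrated out, is the
marginal law of the observation times the Bayes predictive law. -/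
theorem lintegral_gaussianDensity_mul_gaussianPrior (hn : n ≠ 0) (s : Fin n → ℝ≥0)
    (x y : Fin n → ℝ) :
    ∫⁻ θ, ENNReal.ofReal (gaussianDensity θ (1 / (n : ℝ≥0)) x) *
        ENNReal.ofReal (gaussianDensity θ (1 / (n : ℝ≥0)) y) ∂(gaussianPrior s) =
      ENNReal.ofReal (∏ i, gaussianPDFReal 0 (s i + 1 / (n : ℝ≥0)) (x i)) *
        ENNReal.ofReal (linearPredictiveDensity n s x y) := by
  have hv := one_div_natCast_ne_zero hn
  have hpos : 0 < ∏ i, gaussianPDFReal 0 (s i + 1 / (n : ℝ≥0)) (x i) :=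
    prod_gaussianPDFReal_pos (fun _ => 0) (fun i => by positivity) x
  have h := integral_gaussianDensity_mul_gaussianPrior hn s x y
  rw [← linearPredictiveDensity_eq hn] at h
  rw [← ENNReal.ofReal_mul hpos.le, ← h, ofReal_integral_eq_lintegral_ofReal]
  · simp_rw [ENNReal.ofReal_mul (gaussianDensity_pos _ hv x).le]
  · -- A function whose Bochner integral does not vanish is integrable.
    by_contra hni
    rw [integral_undef hni] at h
    exact (mul_pos hpos (linearPredictiveDensity_pos hn s x y)).ne h
  · exact ae_of_all _ fun θ =>
      (mul_pos (gaussianDensity_pos θ hv x) (gaussianDensity_pos θ hv y)).le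

theorem measurable_uncurry_div (hn : n ≠ 0) (s : Fin n → ℝ≥0)
    {p : (Fin n → ℝ) → (Fin n → ℝ) → ℝ} (hp : IsPredictiveDensity p) :
    Measurable (Function.uncurry fun x y =>
      ENNReal.ofReal (p x y / linearPredictiveDensity n s x y)) := by
  have h := (Measurable.div hp.measurable (measurable_linearPredictiveDensity hn s)).ennreal_ofReal
  convert h using 1
  funext q
  rfl

theorem lintegral_mul_mul_swap {E F : Type*} [MeasurableSpace E] [MeasurableSpace F]
    {π : Measure F} [SFinite π] {ν : Measure E} [SFinite ν] {d : F → E → ℝ≥0∞} {g : E → E → ℝ≥0∞}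
    (hd : Measurable (Function.uncurry d)) (hg : Measurable (Function.uncurry g)) :
    ∫⁻ θ, ∫⁻ x, d θ x * ∫⁻ y, d θ y * g x y ∂ν ∂ν ∂π =
      ∫⁻ x, ∫⁻ y, (∫⁻ θ, d θ x * d θ y ∂π) * g x y ∂ν ∂ν := by
  have hm (z) : Measurable fun θ => d θ z := hd.of_uncurry_right
  have m3 : Measurable fun q : (F × E) × E => d q.1.1 q.2 * g q.1.2 q.2 :=
    (hd.comp (by fun_prop : Measurable fun q : (F × E) × E => (q.1.1, q.2))).mul
      (hg.comp (by fun_prop : Measurable fun q : (F × E) × E => (q.1.2, q.2)))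
  rw [lintegral_lintegral_swap]
  · refine lintegral_congr fun x => ?_
    have e : ∀ θ, d θ x * ∫⁻ y, d θ y * g x y ∂ν = ∫⁻ y, d θ x * (d θ y * g x y) ∂ν := fun θ =>
      (lintegral_const_mul _ (hd.of_uncurry_left.mul hg.of_uncurry_left)).symm
    simp_rw [e]
    rw [lintegral_lintegral_swap]
    · refine lintegral_congr fun y => ?_
      simp_rw [← mul_assoc]
      exact lintegral_mul_const _ ((hm x).mul (hm y))
    · exact Measurable.aemeasurable (((hm x).comp measurable_fst).mul
        (m3.comp (by fun_prop : Measurable fun q : F × E => ((q.1, x), q.2))))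
  · exact Measurable.aemeasurable (hd.mul (Measurable.lintegral_prod_right' m3))

/-- Under the joint law of parameter, observation and future observation, the density ratio of
any predictive density to the Bayes predictive density has mean one. -/
theorem lintegral_div_linearPredictiveDensity (hn : n ≠ 0) (s : Fin n → ℝ≥0)
    {p : (Fin n → ℝ) → (Fin n → ℝ) → ℝ} (hp : IsPredictiveDensity p) :
    ∫⁻ θ, ∫⁻ x, ∫⁻ y, ENNReal.ofReal (p x y / linearPredictiveDensity n s x y)
        ∂gaussianLaw θ (1 / (n : ℝ≥0)) ∂gaussianLaw θ (1 / (n : ℝ≥0)) ∂gaussianPrior s = 1 := by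
  have hv := one_div_natCast_ne_zero hn
  set v : ℝ≥0 := 1 / (n : ℝ≥0) with hvdef
  set g : (Fin n → ℝ) → (Fin n → ℝ) → ℝ≥0∞ :=
    fun x y => ENNReal.ofReal (p x y / linearPredictiveDensity n s x y) with hg
  set d : (Fin n → ℝ) → (Fin n → ℝ) → ℝ≥0∞ :=
    fun θ x => ENNReal.ofReal (gaussianDensity θ v x) with hd
  have hgm : Measurable (Function.uncurry g) := measurable_uncurry_div hn s hp
  have hdm : Measurable (Function.uncurry d) :=
    (measurable_uncurry_gaussianDensity v).ennreal_ofReal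
  have e1 : ∀ θ, ∫⁻ x, ∫⁻ y, g x y ∂gaussianLaw θ v ∂gaussianLaw θ v =
      ∫⁻ x, d θ x * ∫⁻ y, d θ y * g x y := fun θ => by
    have e0 : ∀ x, ∫⁻ y, g x y ∂gaussianLaw θ v = ∫⁻ y, d θ y * g x y := fun x =>
      lintegral_gaussianLaw θ hv hgm.of_uncurry_left
    refine (lintegral_congr e0).trans ?_
    exact lintegral_gaussianLaw θ hv (Measurable.lintegral_prod_right'
      (f := fun q : (Fin n → ℝ) × (Fin n → ℝ) => d θ q.2 * g q.1 q.2)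
      ((hdm.of_uncurry_left.comp measurable_snd).mul hgm))
  have e2 : ∀ x, ∫⁻ y, (∫⁻ θ, d θ x * d θ y ∂gaussianPrior s) * g x y =
      ENNReal.ofReal (∏ i, gaussianPDFReal 0 (s i + v) (x i)) := fun x => by
    have e3 : ∀ y, (∫⁻ θ, d θ x * d θ y ∂gaussianPrior s) * g x y =
        ENNReal.ofReal (∏ i, gaussianPDFReal 0 (s i + v) (x i)) * ENNReal.ofReal (p x y) :=
      fun y => by
      have hpos := linearPredictiveDensity_pos hn s x y
      rw [lintegral_gaussianDensity_mul_gaussianPrior hn s x y, mul_assoc,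
        ← ENNReal.ofReal_mul hpos.le, mul_div_cancel₀ _ hpos.ne']
    simp_rw [e3]
    rw [lintegral_const_mul _ hp.measurable.of_uncurry_left.ennreal_ofReal, hp.lintegral_eq_one,
      mul_one]
  refine (lintegral_congr e1).trans ((lintegral_mul_mul_swap hdm hgm).trans ?_)
  refine (lintegral_congr e2).trans ?_
  rw [← setLIntegral_univ, ← withDensity_apply _ MeasurableSet.univ,
    ← pi_gaussianReal_eq_withDensity (fun _ => 0) _ fun i => by positivity, measure_univ]

/-- The excess risk of the Bayes predictive density over `p` at `θ` is bounded by the mean of a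
density ratio whose average over the prior is one. -/
theorem klRisk_linearPredictiveDensity_le (hn : n ≠ 0) (s : Fin n → ℝ≥0)
    {p : (Fin n → ℝ) → (Fin n → ℝ) → ℝ} (hp : IsPredictiveDensity p) (θ : Fin n → ℝ) :
    n * klRisk n θ (linearPredictiveDensity n s) ≤
      n * klRisk n θ p + ∫⁻ x, ∫⁻ y, ENNReal.ofReal (p x y / linearPredictiveDensity n s x y)
        ∂gaussianLaw θ (1 / (n : ℝ≥0)) ∂gaussianLaw θ (1 / (n : ℝ≥0)) := by
  have hv := one_div_natCast_ne_zero hn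
  have hn0 : (n : ℝ≥0∞) ≠ 0 := by simpa using hn
  simp only [klRisk, ← mul_assoc, ENNReal.mul_inv_cancel hn0 (ENNReal.natCast_ne_top n), one_mul]
  set v : ℝ≥0 := 1 / (n : ℝ≥0) with hvdef
  rw [← lintegral_add_right]
  · refine lintegral_mono fun x => ?_
    have hpx : Measurable (p x) := hp.measurable.of_uncurry_left
    have hrx : Measurable (linearPredictiveDensity n s x) :=
      (measurable_linearPredictiveDensity hn s).of_uncurry_left
    have hQ : IsProbabilityMeasure (volume.withDensity fun y => ENNReal.ofReal (p x y)) :=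
      ⟨by rw [withDensity_apply _ MeasurableSet.univ, setLIntegral_univ, hp.lintegral_eq_one]⟩
    rw [withDensity_ofReal_eq hpx hrx (linearPredictiveDensity_pos hn s x)] at hQ ⊢
    rw [withDensity_linearPredictiveDensity hn] at hQ ⊢
    exact klDiv_le_klDiv_withDensity_add_lintegral (by fun_prop)
      (pi_gaussianReal_absolutelyContinuous _ _ (fun _ => hv) fun i => by positivity)
      (integrable_llr_pi_gaussianReal _ _ (fun _ => hv) fun i => by positivity)
  · exact Measurable.lintegral_prod_right (measurable_uncurry_div hn s hp)

/-- If the risk of a predictive density is at most `B` on `D`, then the part over `D` of the Bayes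
risk of a Gaussian prior exceeds `B` by at most `1 / n`. The prior need not be supported in `D`. -/
theorem setLIntegral_klRisk_linearPredictiveDensity_le (hn : n ≠ 0) (s : Fin n → ℝ≥0)
    {p : (Fin n → ℝ) → (Fin n → ℝ) → ℝ} (hp : IsPredictiveDensity p) {D : Set (Fin n → ℝ)}
    (hD : MeasurableSet D) {B : ℝ≥0∞} (hB : ∀ θ ∈ D, klRisk n θ p ≤ B) :
    ∫⁻ θ in D, n * klRisk n θ (linearPredictiveDensity n s) ∂gaussianPrior s ≤ n * B + 1 := by
  calc ∫⁻ θ in D, n * klRisk n θ (linearPredictiveDensity n s) ∂gaussianPrior s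
      ≤ ∫⁻ θ in D, (n * B + ∫⁻ x, ∫⁻ y, ENNReal.ofReal (p x y / linearPredictiveDensity n s x y)
        ∂gaussianLaw θ (1 / (n : ℝ≥0)) ∂gaussianLaw θ (1 / (n : ℝ≥0))) ∂gaussianPrior s :=
        setLIntegral_mono' hD fun θ hθ => (klRisk_linearPredictiveDensity_le hn s hp θ).trans
          (by gcongr; exact hB θ hθ)
    _ ≤ n * B + 1 := by
        rw [lintegral_add_left measurable_const, setLIntegral_const]
        refine add_le_add (mul_le_of_le_one_right' prob_le_one) ?_
        exact (setLIntegral_le_lintegral _ _).trans_eq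
          (lintegral_div_linearPredictiveDensity hn s hp)

/-! ### Risk bounds for a least favourable Gaussian prior -/

theorem integrable_pow_four_gaussianReal (s : ℝ≥0) :
    Integrable (fun z => z ^ 4) (gaussianReal 0 s) := by
  have := (memLp_id_gaussianReal (μ := 0) (v := s) 4).integrable_norm_pow (p := 4) (by norm_num)
  refine this.congr (ae_of_all _ fun z => ?_)
  simp [Real.norm_eq_abs, (by decide : Even 4).pow_abs]

/-- Centred Gaussian fourth moments scale with the square of the variance. Only the existence of the
constant matters. -/
theorem exists_integral_pow_four_gaussianReal :
    ∃ κ : ℝ, ∀ s : ℝ≥0, ∫ z, z ^ 4 ∂gaussianReal 0 s = κ * (s : ℝ) ^ 2 := by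
  refine ⟨∫ z, z ^ 4 ∂gaussianReal 0 1, fun s => ?_⟩
  have h := gaussianReal_map_const_mul (μ := 0) (v := 1) (√(s : ℝ))
  have hs : NNReal.mk (√(s : ℝ) ^ 2) (sq_nonneg _) * 1 = s := by
    ext
    simp
  rw [hs, mul_zero] at h
  rw [← h, integral_map (by fun_prop) (by fun_prop)]
  simp_rw [mul_pow]
  rw [integral_const_mul, mul_comm, show (√(s : ℝ)) ^ 4 = (√(s : ℝ) ^ 2) ^ 2 by ring,
    Real.sq_sqrt s.coe_nonneg]

/-- The slope of `coordRisk w`. -/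
noncomputable def riskSlope (w : ℝ) : ℝ := (1 - w) ^ 2 / (1 + w)

/-- The product of the slope of `coordRisk w` with the normalized prior variance `w / (1 - w)` that
gives the shrinkage factor `w`. -/
noncomputable def riskBudget (w : ℝ) : ℝ := w * (1 - w) / (1 + w)

theorem coordRisk_eq (w t : ℝ) :
    coordRisk w t = 1 / 2 * (Real.log (1 + w) - riskBudget w + riskSlope w * t) := rfl

theorem riskSlope_mul (w : ℝ) (hw : 0 ≤ w) (hw1 : w < 1) :
    riskSlope w * (w / (1 - w)) = riskBudget w := by
  have h1 : 1 - w ≠ 0 := by linarith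
  have h2 : 1 + w ≠ 0 := by linarith
  rw [riskSlope, riskBudget]
  field_simp

theorem riskSlope_nonneg {w : ℝ} (hw : 0 ≤ w) : 0 ≤ riskSlope w := by
  unfold riskSlope; positivity

theorem riskBudget_nonneg {w : ℝ} (hw : 0 ≤ w) (hw1 : w ≤ 1) : 0 ≤ riskBudget w :=
  div_nonneg (mul_nonneg hw (by linarith)) (by linarith)

theorem coordRisk_nonneg {w t : ℝ} (hw : 0 ≤ w) (ht : 0 ≤ t) : 0 ≤ coordRisk w t := by
  have h := Real.one_sub_inv_le_log_of_pos (by linarith : 0 < 1 + w)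
  have h2 : riskBudget w ≤ 1 - (1 + w)⁻¹ := by
    rw [riskBudget, div_le_iff₀ (by linarith), sub_mul, inv_mul_cancel₀ (by linarith)]
    nlinarith
  rw [coordRisk_eq]
  have := mul_nonneg (riskSlope_nonneg hw) ht
  linarith

/-- The prior variance for which the shrinkage factor at noise level `1 / n` is `w`. -/
noncomputable def priorVariance (n : ℕ) (w : ℝ) : ℝ≥0 := (w / (1 - w)).toNNReal / n

theorem natCast_mul_priorVariance {n : ℕ} (hn : n ≠ 0) {w : ℝ} (hw : 0 ≤ w) (hw1 : w < 1) :
    (n : ℝ) * priorVariance n w = w / (1 - w) := by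
  have : (n : ℝ) ≠ 0 := by exact_mod_cast hn
  rw [priorVariance, NNReal.coe_div, NNReal.coe_natCast, mul_div_cancel₀ _ this,
    Real.coe_toNNReal _ (div_nonneg hw (by linarith))]

theorem shrinkFactor_priorVariance {n : ℕ} (hn : n ≠ 0) {w : ℝ} (hw : 0 ≤ w) (hw1 : w < 1) :
    (shrinkFactor (1 / (n : ℝ≥0)) (priorVariance n w) : ℝ) = w := by
  have hn' : (n : ℝ) ≠ 0 := by exact_mod_cast hn
  have h1 : 1 - w ≠ 0 := by linarith
  have h := natCast_mul_priorVariance hn hw hw1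
  have e : (priorVariance n w : ℝ) = w / (1 - w) / n := by rw [← h]; field_simp
  simp only [shrinkFactor, NNReal.coe_div, NNReal.coe_add, NNReal.coe_one, NNReal.coe_natCast]
  rw [e]
  field_simp
  ring

theorem natCast_mul_klRisk_priorVariance (hn : n ≠ 0) {w : Fin n → ℝ} (hw : ∀ i, 0 ≤ w i)
    (hw1 : ∀ i, w i < 1) (θ : Fin n → ℝ) :
    n * klRisk n θ (linearPredictiveDensity n fun i => priorVariance n (w i)) =
      ENNReal.ofReal (∑ i, coordRisk (w i) (n * θ i ^ 2)) := by
  have hn0 : (n : ℝ≥0∞) ≠ 0 := by simpa using hn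
  rw [klRisk_linearPredictiveDensity hn, ← mul_assoc,
    ENNReal.mul_inv_cancel hn0 (ENNReal.natCast_ne_top n), one_mul]
  simp_rw [shrinkFactor_priorVariance hn (hw _) (hw1 _)]

/-- The linear minimax risk over a set on which the normalized quadratic form
`∑ Y i * (n * θ i ^ 2)` is at most `b`, bounded through the Gaussian prior with shrinkage factors
`w`. The weights `Y` dominate the slopes of the risk, which is affine in the squared means. -/
theorem linearMinimaxRisk_le (hn : n ≠ 0) {w Y : Fin n → ℝ} (hw : ∀ i, 0 ≤ w i)
    (hw1 : ∀ i, w i < 1) (hY : ∀ i, riskSlope (w i) ≤ Y i) {b : ℝ} {Θ : Set (ℕ → ℝ)}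
    (hΘ : ∀ θ ∈ Θ, ∑ i, Y i * (n * firstCoords n θ i ^ 2) ≤ b) :
    n * linearMinimaxRisk n n Θ ≤
      ENNReal.ofReal (1 / 2 * (∑ i, Real.log (1 + w i) - ∑ i, riskBudget (w i) + b)) := by
  have hn0 : (n : ℝ≥0∞) ≠ 0 := by simpa using hn
  rw [ENNReal.mul_le_iff_le_inv hn0 (ENNReal.natCast_ne_top n)]
  refine (iInf_le _ fun i => priorVariance n (w i)).trans (iSup₂_le fun θ hθ => ?_)
  rw [← ENNReal.mul_le_iff_le_inv hn0 (ENNReal.natCast_ne_top n),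
    natCast_mul_klRisk_priorVariance hn hw hw1]
  refine ENNReal.ofReal_le_ofReal ?_
  simp_rw [coordRisk_eq]
  rw [← Finset.mul_sum, Finset.sum_add_distrib, Finset.sum_sub_distrib]
  have : ∑ i, riskSlope (w i) * (n * firstCoords n θ i ^ 2) ≤
      ∑ i, Y i * (n * firstCoords n θ i ^ 2) :=
    Finset.sum_le_sum fun i _ => mul_le_mul_of_nonneg_right (hY i) (by positivity)
  linarith [hΘ θ hθ]

theorem integral_natCast_mul_sq_priorVariance (hn : n ≠ 0) {w : ℝ} (hw : 0 ≤ w) (hw1 : w < 1) :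
    ∫ z, n * z ^ 2 ∂gaussianReal 0 (priorVariance n w) = w / (1 - w) := by
  rw [integral_const_mul, integral_sq_gaussianReal]
  simp [natCast_mul_priorVariance hn hw hw1]

/-- The Bayes risk, in units of `1 / n`: at the mean `w / (1 - w)` of `n * θ ^ 2` the terms of
`coordRisk w` other than the logarithm cancel. -/
theorem integral_coordRisk (hn : n ≠ 0) {w : Fin n → ℝ} (hw : ∀ i, 0 ≤ w i)
    (hw1 : ∀ i, w i < 1) :
    Integrable (fun θ => ∑ i, coordRisk (w i) (n * θ i ^ 2))
        (gaussianPrior fun i => priorVariance n (w i)) ∧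
      ∫ θ, ∑ i, coordRisk (w i) (n * θ i ^ 2) ∂(gaussianPrior fun i => priorVariance n (w i)) =
        1 / 2 * ∑ i, Real.log (1 + w i) := by
  have hsq (i) : Integrable (fun z : ℝ => (n : ℝ) * z ^ 2)
      (gaussianReal 0 (priorVariance n (w i))) :=
    (integrable_sq_gaussianReal _ _).const_mul _
  have hi (i) : Integrable (fun z : ℝ => coordRisk (w i) (n * z ^ 2))
      (gaussianReal 0 (priorVariance n (w i))) :=
    ((integrable_const _).add ((hsq i).const_mul _)).const_mul _
  have hi' (i) : Integrable (fun θ : Fin n → ℝ => coordRisk (w i) (n * θ i ^ 2))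
      (gaussianPrior fun i => priorVariance n (w i)) :=
    integrable_comp_eval (μ := fun i => gaussianReal 0 (priorVariance n (w i))) (hi i)
  refine ⟨integrable_finsetSum _ fun i _ => hi' i, ?_⟩
  rw [integral_finsetSum _ fun i _ => hi' i, Finset.mul_sum]
  refine Finset.sum_congr rfl fun i _ => ?_
  rw [gaussianPrior, integral_comp_eval (μ := fun i => gaussianReal 0 (priorVariance n (w i)))
    (hi i).aestronglyMeasurable]
  simp_rw [coordRisk_eq]
  rw [integral_const_mul, integral_add (integrable_const _) ((hsq i).const_mul _),
    integral_const_mul, integral_natCast_mul_sq_priorVariance hn (hw i) (hw1 i),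
    riskSlope_mul _ (hw i) (hw1 i)]
  simp

/-- Under the prior the quadratic form `∑ Y i * (n * θ i ^ 2)` has mean `∑ riskBudget (w i)`; its
variance is at most `κ ∑ riskBudget (w i) ^ 2`, with `κ` the standard Gaussian fourth moment. -/
theorem integral_sq_sub_le (hn : n ≠ 0) {w Y : Fin n → ℝ} (hw : ∀ i, 0 ≤ w i)
    (hw1 : ∀ i, w i < 1) (hY : ∀ i, w i ≠ 0 → Y i = riskSlope (w i)) {κ : ℝ}
    (hκ : ∀ s : ℝ≥0, ∫ z, z ^ 4 ∂gaussianReal 0 s = κ * (s : ℝ) ^ 2) :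
    Integrable (fun θ => (∑ i, Y i * (n * θ i ^ 2) - ∑ i, riskBudget (w i)) ^ 2)
        (gaussianPrior fun i => priorVariance n (w i)) ∧
      ∫ θ, (∑ i, Y i * (n * θ i ^ 2) - ∑ i, riskBudget (w i)) ^ 2
        ∂(gaussianPrior fun i => priorVariance n (w i)) ≤ κ * ∑ i, riskBudget (w i) ^ 2 := by
  set s : Fin n → ℝ≥0 := fun i => priorVariance n (w i) with hs
  set X : Fin n → ℝ → ℝ := fun i z => Y i * (n * z ^ 2) with hX
  have hYb (i) : Y i * (w i / (1 - w i)) = riskBudget (w i) := by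
    by_cases h : w i = 0
    · simp [h, riskBudget]
    · rw [hY i h, riskSlope_mul _ (hw i) (hw1 i)]
  have hXsq (i) : (fun z => X i z ^ 2) = fun z => (Y i * n) ^ 2 * z ^ 4 := by
    ext z
    simp only [hX]
    ring
  have hXL (i) : MemLp (X i) 2 (gaussianReal 0 (s i)) := by
    rw [memLp_two_iff_integrable_sq (by fun_prop), hXsq]
    exact (integrable_pow_four_gaussianReal _).const_mul _
  have hXm (i) : ∫ z, X i z ∂gaussianReal 0 (s i) = riskBudget (w i) := by
    rw [integral_const_mul, integral_natCast_mul_sq_priorVariance hn (hw i) (hw1 i), hYb]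
  have hXi (i) : Integrable (X i) (gaussianReal 0 (s i)) := (hXL i).integrable one_le_two
  have hQi (i) : Integrable (fun θ : Fin n → ℝ => X i (θ i)) (gaussianPrior s) :=
    integrable_comp_eval (μ := fun i => gaussianReal 0 (s i)) (hXi i)
  have hQ : ∫ θ, ∑ i, X i (θ i) ∂gaussianPrior s = ∑ i, riskBudget (w i) := by
    rw [integral_finsetSum _ fun i _ => hQi i]
    refine Finset.sum_congr rfl fun i _ => ?_
    rw [gaussianPrior, integral_comp_eval (μ := fun i => gaussianReal 0 (s i))
      (hXi i).aestronglyMeasurable, hXm]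
  have hQL : MemLp (fun θ : Fin n → ℝ => ∑ i, X i (θ i)) 2 (gaussianPrior s) :=
    memLp_finsetSum _ fun i _ => (hXL i).comp_measurePreserving
      (measurePreserving_eval (fun i => gaussianReal 0 (s i)) i)
  have hvar := variance_sum_pi (μ := fun i => gaussianReal 0 (s i)) hXL
  have hfun : (∑ i, fun θ : Fin n → ℝ => X i (θ i)) = fun θ => ∑ i, X i (θ i) := by
    ext θ
    simp
  rw [hfun] at hvar
  change Var[fun θ => ∑ i, X i (θ i); gaussianPrior s] = _ at hvar
  rw [variance_eq_integral hQL.aestronglyMeasurable.aemeasurable, hQ] at hvar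
  refine ⟨(hQL.sub (memLp_const _)).integrable_sq, hvar.trans_le ?_⟩
  rw [Finset.mul_sum]
  refine Finset.sum_le_sum fun i _ => ?_
  refine (variance_le_expectation_sq (hXL i).aestronglyMeasurable).trans_eq ?_
  change ∫ z, X i z ^ 2 ∂gaussianReal 0 (s i) = _
  rw [hXsq, integral_const_mul, hκ, ← hYb, ← natCast_mul_priorVariance hn (hw i) (hw1 i)]
  simp only [hs]
  ring

/-- The minimax risk over a set that contains the ellipsoid `∑ Y i * (n * θ i ^ 2) ≤ b`, bounded
below through the Gaussian prior with shrinkage factors `w`. The prior gives mean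
`∑ riskBudget (w i) < b` to the quadratic form; its mass outside of the ellipsoid is paid for by
the variance of the form. -/
theorem le_minimaxRisk (hn : n ≠ 0) {w Y : Fin n → ℝ} (hw : ∀ i, 0 ≤ w i)
    (hw1 : ∀ i, w i < 1) (hYle : ∀ i, riskSlope (w i) ≤ Y i)
    (hY : ∀ i, w i ≠ 0 → Y i = riskSlope (w i)) {κ : ℝ}
    (hκ : ∀ s : ℝ≥0, ∫ z, z ^ 4 ∂gaussianReal 0 s = κ * (s : ℝ) ^ 2) {δ : ℝ} (hδ : 0 < δ)
    {Θ : Set (ℕ → ℝ)}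
    (hΘ : ∀ θ : Fin n → ℝ, ∑ i, Y i * (n * θ i ^ 2) ≤ ∑ i, riskBudget (w i) + δ →
      ∃ θ' ∈ Θ, firstCoords n θ' = θ) :
    ENNReal.ofReal (1 / 2 * ∑ i, Real.log (1 + w i) -
      1 / 2 * ((∑ i, Real.log (1 + w i) + ∑ i, riskBudget (w i)) / δ ^ 2 + 1 / δ) *
        (κ * ∑ i, riskBudget (w i) ^ 2)) ≤ n * minimaxRisk n n Θ + 1 := by
  have hn0 : (n : ℝ≥0∞) ≠ 0 := by simpa using hn
  set s : Fin n → ℝ≥0 := fun i => priorVariance n (w i) with hs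
  set β := ∑ i, riskBudget (w i) with hβ
  set G := ∑ i, Real.log (1 + w i) with hG
  set c := 1 / 2 * ((G + β) / δ ^ 2 + 1 / δ) with hc
  have hβ0 : 0 ≤ β := Finset.sum_nonneg fun i _ => riskBudget_nonneg (hw i) (hw1 i).le
  have hG0 : 0 ≤ G := Finset.sum_nonneg fun i _ => Real.log_nonneg (by linarith [hw i])
  set q : (Fin n → ℝ) → ℝ := fun θ => ∑ i, Y i * (n * θ i ^ 2) with hq
  set f : (Fin n → ℝ) → ℝ := fun θ => ∑ i, coordRisk (w i) (n * θ i ^ 2) with hf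
  have hf0 : ∀ θ, 0 ≤ f θ := fun θ =>
    Finset.sum_nonneg fun i _ => coordRisk_nonneg (hw i) (by positivity)
  have hqm : Measurable q := by fun_prop
  set D : Set (Fin n → ℝ) := {θ | q θ ≤ β + δ} with hD
  have hDm : MeasurableSet D := hqm measurableSet_Iic
  obtain ⟨hfi, hfe⟩ := integral_coordRisk hn hw hw1
  obtain ⟨hqi, hqe⟩ := integral_sq_sub_le hn hw hw1 hY hκ
  have hfq : ∀ θ, f θ ≤ 1 / 2 * (G + q θ) := fun θ => by
    simp only [hf, hq, hG, coordRisk_eq, Finset.mul_sum, ← Finset.sum_add_distrib]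
    refine Finset.sum_le_sum fun i _ => ?_
    have h1 := riskBudget_nonneg (hw i) (hw1 i).le
    have h2 := mul_le_mul_of_nonneg_right (hYle i) (by positivity : 0 ≤ n * θ i ^ 2)
    linarith
  -- Outside of `D` the form exceeds its mean by at least `δ`, so that a quadratic dominates the
  -- affine bound `hfq`; the constant `c` is chosen for this.
  have hpt : ∀ θ, f θ - c * (q θ - β) ^ 2 ≤ D.indicator f θ := fun θ => by
    by_cases hθ : θ ∈ D
    · rw [Set.indicator_of_mem hθ]
      have : 0 ≤ c := by positivity
      nlinarith [sq_nonneg (q θ - β)]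
    · rw [Set.indicator_of_notMem hθ]
      have hgt : δ < q θ - β := by
        have := not_le.1 (show ¬ q θ ≤ β + δ from hθ)
        linarith
      have h1 : (G + β) ≤ (G + β) / δ ^ 2 * (q θ - β) ^ 2 := by
        rw [div_mul_eq_mul_div, le_div_iff₀ (by positivity)]
        exact mul_le_mul_of_nonneg_left (pow_le_pow_left₀ hδ.le hgt.le 2) (by positivity)
      have h2 : (q θ - β) ≤ 1 / δ * (q θ - β) ^ 2 := by
        rw [div_mul_eq_mul_div, le_div_iff₀ hδ]
        nlinarith
      have h3 := hfq θ
      have : c * (q θ - β) ^ 2 = 1 / 2 * ((G + β) / δ ^ 2 * (q θ - β) ^ 2 +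
        1 / δ * (q θ - β) ^ 2) := by rw [hc]; ring
      linarith
  have hint : 1 / 2 * G - c * (κ * ∑ i, riskBudget (w i) ^ 2) ≤ ∫ θ in D, f θ ∂gaussianPrior s := by
    rw [← integral_indicator hDm]
    have h := integral_mono (hfi.sub (hqi.const_mul c)) (hfi.indicator hDm) hpt
    rw [integral_sub' hfi (hqi.const_mul c), integral_const_mul, hfe] at h
    have hc0 : 0 ≤ c := by positivity
    have := mul_le_mul_of_nonneg_left hqe hc0
    linarith
  refine (ENNReal.ofReal_le_ofReal hint).trans ?_
  rw [ofReal_integral_eq_lintegral_ofReal hfi.restrict (ae_of_all _ hf0)]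
  have hbd : ∀ p : (Fin n → ℝ) → (Fin n → ℝ) → ℝ, IsPredictiveDensity p →
      ∫⁻ θ in D, ENNReal.ofReal (f θ) ∂gaussianPrior s ≤
        n * (⨆ θ ∈ Θ, klRisk n (firstCoords n θ) p) + 1 := fun p hp => by
    simp_rw [hf, ← natCast_mul_klRisk_priorVariance hn hw hw1]
    refine setLIntegral_klRisk_linearPredictiveDensity_le hn s hp hDm fun θ hθ => ?_
    obtain ⟨θ', hθ', rfl⟩ := hΘ θ hθ
    exact le_iSup₂ (f := fun θ (_ : θ ∈ Θ) => klRisk n (firstCoords n θ) p) θ' hθ'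
  rw [← tsub_le_iff_right, minimaxRisk, ENNReal.mul_iInf_of_ne hn0 (ENNReal.natCast_ne_top n)]
  refine le_iInf fun p => ?_
  rw [ENNReal.mul_iInf_of_ne hn0 (ENNReal.natCast_ne_top n)]
  refine le_iInf fun hp => ?_
  rw [tsub_le_iff_right]
  exact hbd p hp

/-! ### The binomial series of the square root -/

theorem choose_half_succ (k : ℕ) :
    Ring.choose (1 / 2 : ℝ) (k + 1) = Ring.choose (1 / 2 : ℝ) k * ((1 / 2 - k) / (k + 1)) := by
  have hk : ((k : ℝ) + 1) ≠ 0 := by positivity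
  have hk' : (k.factorial : ℝ) ≠ 0 := by positivity
  rw [Ring.choose_eq_smul, Ring.choose_eq_smul, descPochhammer_succ_right, Polynomial.smeval_mul,
    Nat.factorial_succ]
  simp only [Polynomial.smeval_sub, Polynomial.smeval_X, Polynomial.smeval_natCast, pow_one,
    pow_zero, smul_eq_mul, nsmul_eq_mul, mul_one, Nat.cast_mul, Nat.cast_add, Nat.cast_one]
  field_simp

/-- Makes the geometric series of ratio `1 / 8` a dominating series. -/
theorem abs_choose_half_le_one (k : ℕ) : |Ring.choose (1 / 2 : ℝ) k| ≤ 1 := by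
  induction k with
  | zero => simp
  | succ k ih =>
    rw [choose_half_succ, abs_mul]
    refine mul_le_one₀ ih (abs_nonneg _) ?_
    have hk : (0 : ℝ) ≤ k := k.cast_nonneg
    rw [abs_le, le_div_iff₀ (by positivity), div_le_iff₀ (by positivity)]
    constructor <;> linarith

theorem choose_half_eq (k : ℕ) :
    Ring.choose (1 / 2 : ℝ) k =
      (-1) ^ k * ((2 * k).factorial : ℝ) / ((1 - 2 * (k : ℝ)) * (k.factorial : ℝ) ^ 2 * 4 ^ k) := by
  have hodd : ∀ k : ℕ, (1 - 2 * (k : ℝ)) ≠ 0 := fun k h => by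
    have : ((1 : ℤ) - 2 * k) = 0 := by exact_mod_cast h
    omega
  induction k with
  | zero => simp
  | succ k ih =>
    have h1 := hodd k
    have h2 := hodd (k + 1)
    have hk : ((k : ℝ) + 1) ≠ 0 := by positivity
    have hk' : (k.factorial : ℝ) ≠ 0 := by positivity
    rw [choose_half_succ, ih, show 2 * (k + 1) = 2 * k + 1 + 1 by ring, Nat.factorial_succ,
      Nat.factorial_succ, Nat.factorial_succ]
    push_cast at h2 ⊢
    field_simp
    ring

theorem hasSum_sqrt_one_add {z : ℝ} (hz0 : 0 ≤ z) (hz : z < 1) :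
    HasSum (fun k => Ring.choose (1 / 2 : ℝ) k * z ^ k) √(1 + z) := by
  have h := (Real.one_add_rpow_hasFPowerSeriesOnBall_zero (a := 1 / 2)).hasSum (y := z) (by
    rw [Metric.mem_eball, edist_dist, Real.dist_eq, sub_zero, abs_of_nonneg hz0]
    simpa using hz)
  simpa [Real.sqrt_eq_rpow, binomialSeries, FormalMultilinearSeries.coeff_ofScalars, mul_comm]
    using h

/-! ### The shrinkage profile -/

/-- The shrinkage factor at which `coordRisk` has slope `y`, for `0 ≤ y ≤ 1`. -/
noncomputable def shrinkOf (y : ℝ) : ℝ := 1 + y / 2 - √(y ^ 2 + 8 * y) / 2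

theorem continuous_shrinkOf : Continuous shrinkOf := by
  unfold shrinkOf; fun_prop

theorem shrinkOf_one : shrinkOf 1 = 0 := by
  rw [shrinkOf, show (1 : ℝ) ^ 2 + 8 * 1 = 3 ^ 2 by norm_num, Real.sqrt_sq (by norm_num)]
  norm_num

theorem shrinkOf_nonneg {y : ℝ} (hy0 : 0 ≤ y) (hy : y ≤ 1) : 0 ≤ shrinkOf y := by
  have : √(y ^ 2 + 8 * y) ≤ 2 + y := Real.sqrt_le_iff.2 ⟨by linarith, by nlinarith⟩
  unfold shrinkOf; linarith

theorem shrinkOf_pos {y : ℝ} (hy0 : 0 ≤ y) (hy : y < 1) : 0 < shrinkOf y := by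
  have : √(y ^ 2 + 8 * y) < 2 + y := (Real.sqrt_lt' (by linarith)).2 (by nlinarith)
  unfold shrinkOf; linarith

theorem shrinkOf_le_one {y : ℝ} (hy0 : 0 ≤ y) : shrinkOf y ≤ 1 := by
  have : y ≤ √(y ^ 2 + 8 * y) := Real.le_sqrt_of_sq_le (by linarith)
  unfold shrinkOf; linarith

theorem shrinkOf_lt_one {y : ℝ} (hy0 : 0 < y) : shrinkOf y < 1 := by
  have : y < √(y ^ 2 + 8 * y) := Real.lt_sqrt_of_sq_lt (by linarith)
  unfold shrinkOf; linarith

theorem one_sub_shrinkOf_sq {y : ℝ} (hy0 : 0 ≤ y) :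
    (1 - shrinkOf y) ^ 2 = y * (1 + shrinkOf y) := by
  have h := Real.sq_sqrt (show 0 ≤ y ^ 2 + 8 * y by positivity)
  unfold shrinkOf
  linear_combination h / 4

theorem riskSlope_shrinkOf {y : ℝ} (hy0 : 0 ≤ y) (hy : y ≤ 1) : riskSlope (shrinkOf y) = y := by
  have := shrinkOf_nonneg hy0 hy
  rw [riskSlope, one_sub_shrinkOf_sq hy0, mul_div_cancel_right₀ _ (by linarith)]

theorem riskBudget_shrinkOf {y : ℝ} (hy0 : 0 ≤ y) (hy : y ≤ 1) :
    riskBudget (shrinkOf y) = √(y ^ 2 + 8 * y) / 4 - 3 / 4 * y := by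
  have h0 := shrinkOf_nonneg hy0 hy
  have h1 := one_sub_shrinkOf_sq hy0
  have h2 : √(y ^ 2 + 8 * y) = 2 + y - 2 * shrinkOf y := by unfold shrinkOf; ring
  rw [h2, riskBudget, div_eq_iff (by linarith)]
  linear_combination -h1 / 2

/-- The weight profile `x ↦ x ^ (2α)` on `[0, 1]`, extended by constants. -/
noncomputable def weightProfile (α x : ℝ) : ℝ := (max 0 (min x 1)) ^ (2 * α)

/-- The limiting optimal shrinkage factor at relative frequency `x`; it vanishes for `1 ≤ x`. -/
noncomputable def shrinkProfile (α x : ℝ) : ℝ := shrinkOf (weightProfile α x)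

variable {α : ℝ}

theorem weightProfile_nonneg (x : ℝ) : 0 ≤ weightProfile α x :=
  Real.rpow_nonneg (le_max_left _ _) _

theorem weightProfile_le_one (hα : 0 < α) (x : ℝ) : weightProfile α x ≤ 1 :=
  Real.rpow_le_one (le_max_left _ _) (by simp) (by linarith)

theorem continuous_weightProfile (hα : 0 < α) : Continuous (weightProfile α) := by
  unfold weightProfile
  exact Continuous.rpow_const (by fun_prop) fun _ => Or.inr (by linarith)

theorem weightProfile_of_mem {x : ℝ} (hx0 : 0 ≤ x) (hx : x ≤ 1) :
    weightProfile α x = x ^ (2 * α) := by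
  rw [weightProfile, min_eq_left hx, max_eq_right hx0]

theorem weightProfile_of_one_le {x : ℝ} (hx : 1 ≤ x) : weightProfile α x = 1 := by
  rw [weightProfile, min_eq_right hx, max_eq_right zero_le_one, Real.one_rpow]

theorem weightProfile_pos {x : ℝ} (hx : 0 < x) : 0 < weightProfile α x :=
  Real.rpow_pos_of_pos (lt_max_of_lt_right (lt_min hx one_pos)) _

theorem continuous_shrinkProfile (hα : 0 < α) : Continuous (shrinkProfile α) :=
  continuous_shrinkOf.comp (continuous_weightProfile hα)

theorem shrinkProfile_nonneg (hα : 0 < α) (x : ℝ) : 0 ≤ shrinkProfile α x :=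
  shrinkOf_nonneg (weightProfile_nonneg x) (weightProfile_le_one hα x)

theorem shrinkProfile_of_one_le {x : ℝ} (hx : 1 ≤ x) : shrinkProfile α x = 0 := by
  rw [shrinkProfile, weightProfile_of_one_le hx, shrinkOf_one]

theorem shrinkProfile_lt_one {x : ℝ} (hx : 0 < x) : shrinkProfile α x < 1 :=
  shrinkOf_lt_one (weightProfile_pos hx)

theorem shrinkProfile_pos (hα : 0 < α) {x : ℝ} (hx0 : 0 ≤ x) (hx : x < 1) :
    0 < shrinkProfile α x := by
  refine shrinkOf_pos (weightProfile_nonneg x) ?_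
  rw [weightProfile_of_mem hx0 hx.le]
  exact Real.rpow_lt_one hx0 hx (by linarith)

theorem continuous_riskBudget_shrinkProfile (hα : 0 < α) :
    Continuous fun x => riskBudget (shrinkProfile α x) := by
  have h := continuous_shrinkProfile hα
  unfold riskBudget
  refine Continuous.div (by fun_prop) (by fun_prop) fun x => ?_
  have := shrinkProfile_nonneg hα x
  linarith

theorem continuous_log_shrinkProfile (hα : 0 < α) :
    Continuous fun x => Real.log (1 + shrinkProfile α x) := by
  have h := continuous_shrinkProfile hα
  refine Continuous.log (by fun_prop) fun x => ?_
  have := shrinkProfile_nonneg hα x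
  linarith

/-! ### The constants as integrals of the profile -/

theorem integral_weightProfile (hα : 0 < α) :
    ∫ x in (0 : ℝ)..1, weightProfile α x = 1 / (2 * α + 1) := by
  have : ∫ x in (0 : ℝ)..1, weightProfile α x = ∫ x in (0 : ℝ)..1, x ^ (2 * α) := by
    refine intervalIntegral.integral_congr fun x hx => ?_
    rw [Set.uIcc_of_le zero_le_one] at hx
    exact weightProfile_of_mem hx.1 hx.2
  rw [this, integral_rpow (Or.inl (by linarith)), Real.one_rpow,
    Real.zero_rpow (by linarith), sub_zero]

/-- Termwise integration of `√(y ^ 2 + 8 y) = 2 √2 x ^ α √(1 + y / 8)`, where `y = x ^ (2 α)`. -/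
theorem hasSum_seriesTerm (hα : 0 < α) :
    HasSum (seriesTerm α)
      (∫ x in (0 : ℝ)..1, √(weightProfile α x ^ 2 + 8 * weightProfile α x)) := by
  have hterm : ∀ k : ℕ, ∫ x in (0 : ℝ)..1, 2 * √2 * Ring.choose (1 / 2 : ℝ) k * (1 / 8) ^ k *
      x ^ ((2 * (k : ℝ) + 1) * α) = seriesTerm α k := fun k => by
    have hpos : 0 < (2 * (k : ℝ) + 1) * α := by positivity
    rw [intervalIntegral.integral_const_mul, integral_rpow (Or.inl (by linarith)), Real.one_rpow,
      Real.zero_rpow (by linarith), sub_zero, choose_half_eq, seriesTerm,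
      show (32 : ℝ) = 4 * 8 by norm_num, mul_pow]
    congr 1
    rw [div_pow, one_pow, mul_one_div, mul_div_assoc', div_div]
    congr 1 <;> ring
  rw [← funext hterm]
  refine intervalIntegral.hasSum_integral_of_dominated_convergence
    (fun k _ => 2 * √2 * (1 / 8) ^ k) (fun k => ?_) (fun k => ?_) ?_ ?_ ?_
  · exact Measurable.aestronglyMeasurable (by fun_prop)
  · refine ae_of_all _ fun x hx => ?_
    rw [Set.uIoc_of_le zero_le_one] at hx
    have h1 : x ^ ((2 * (k : ℝ) + 1) * α) ≤ 1 := Real.rpow_le_one hx.1.le hx.2 (by positivity)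
    have h0 : 0 ≤ x ^ ((2 * (k : ℝ) + 1) * α) := Real.rpow_nonneg hx.1.le _
    rw [Real.norm_eq_abs, abs_mul, abs_mul, abs_mul, abs_of_nonneg h0,
      abs_of_nonneg (by positivity : (0 : ℝ) ≤ 2 * √2),
      abs_of_nonneg (by positivity : (0 : ℝ) ≤ (1 / 8) ^ k)]
    calc 2 * √2 * |Ring.choose (1 / 2 : ℝ) k| * (1 / 8) ^ k * x ^ ((2 * (k : ℝ) + 1) * α)
        ≤ 2 * √2 * 1 * (1 / 8) ^ k * 1 := by
          gcongr
          exact abs_choose_half_le_one k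
      _ = 2 * √2 * (1 / 8) ^ k := by ring
  · exact ae_of_all _ fun x _ =>
      (summable_geometric_of_lt_one (by norm_num) (by norm_num)).mul_left _
  · exact intervalIntegrable_const
  · refine ae_of_all _ fun x hx => ?_
    rw [Set.uIoc_of_le zero_le_one] at hx
    have hy0 : 0 ≤ x ^ (2 * α) := Real.rpow_nonneg hx.1.le _
    have hy1 : x ^ (2 * α) ≤ 1 := Real.rpow_le_one hx.1.le hx.2 (by linarith)
    have hxa : 0 ≤ x ^ α := Real.rpow_nonneg hx.1.le _
    have hsq : x ^ (2 * α) = (x ^ α) ^ 2 := by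
      rw [mul_comm, Real.rpow_mul hx.1.le]
      norm_num
    have h := (hasSum_sqrt_one_add (z := x ^ (2 * α) / 8) (by positivity)
      (by linarith)).mul_left (2 * √2 * x ^ α)
    rw [weightProfile_of_mem hx.1.le hx.2]
    have e : 2 * √2 * x ^ α * √(1 + x ^ (2 * α) / 8) =
        √((x ^ (2 * α)) ^ 2 + 8 * x ^ (2 * α)) := by
      symm
      rw [Real.sqrt_eq_iff_mul_self_eq (by positivity) (by positivity)]
      have h2 := Real.mul_self_sqrt (show (0 : ℝ) ≤ 2 by norm_num)
      have h3 := Real.mul_self_sqrt (show 0 ≤ 1 + x ^ (2 * α) / 8 by positivity)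
      symm
      calc 2 * √2 * x ^ α * √(1 + x ^ (2 * α) / 8) * (2 * √2 * x ^ α * √(1 + x ^ (2 * α) / 8))
          = 4 * (√2 * √2) * (x ^ α) ^ 2 *
            (√(1 + x ^ (2 * α) / 8) * √(1 + x ^ (2 * α) / 8)) := by ring
        _ = (x ^ (2 * α)) ^ 2 + 8 * x ^ (2 * α) := by
          rw [h2, h3, ← hsq]
          ring
    rw [e] at h
    convert! h using 1
    funext k
    have hxk : x ^ ((2 * (k : ℝ) + 1) * α) = x ^ α * (x ^ (2 * α)) ^ k := by
      rw [← Real.rpow_mul_natCast hx.1.le, ← Real.rpow_add hx.1]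
      ring_nf
    rw [hxk]
    ring

/-- The limiting budget is `C / M ^ (2 α + 1)`, for every `C > 0`. -/
theorem integral_riskBudget_shrinkProfile (hα : 0 < α) :
    ∫ x in (0 : ℝ)..1, riskBudget (shrinkProfile α x) =
      ((∑' k, seriesTerm α k) - 3 / (2 * α + 1)) / 4 := by
  have hc := continuous_weightProfile hα
  have h : ∀ x, riskBudget (shrinkProfile α x) =
      √(weightProfile α x ^ 2 + 8 * weightProfile α x) / 4 - 3 / 4 * weightProfile α x :=
    fun x => riskBudget_shrinkOf (weightProfile_nonneg x) (weightProfile_le_one hα x)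
  simp_rw [h]
  rw [intervalIntegral.integral_sub (Continuous.intervalIntegrable (by fun_prop) _ _)
    (Continuous.intervalIntegrable (by fun_prop) _ _), intervalIntegral.integral_div,
    intervalIntegral.integral_const_mul, integral_weightProfile hα, (hasSum_seriesTerm hα).tsum_eq]
  ring

theorem integral_shrinkProfile (hα : 0 < α) :
    ∫ x in (0 : ℝ)..1, shrinkProfile α x = constK α := by
  have hc := continuous_weightProfile hα
  simp_rw [shrinkProfile, shrinkOf]
  rw [intervalIntegral.integral_sub (Continuous.intervalIntegrable (by fun_prop) _ _)
    (Continuous.intervalIntegrable (by fun_prop) _ _),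
    intervalIntegral.integral_add (Continuous.intervalIntegrable (by fun_prop) _ _)
    (Continuous.intervalIntegrable (by fun_prop) _ _), intervalIntegral.integral_div,
    intervalIntegral.integral_div, integral_weightProfile hα, constK,
    (hasSum_seriesTerm hα).tsum_eq, intervalIntegral.integral_const]
  rw [sub_zero, one_smul, div_div, mul_comm (2 * α + 1)]
  ring

theorem integral_riskBudget_shrinkProfile_pos (hα : 0 < α) :
    0 < ∫ x in (0 : ℝ)..1, riskBudget (shrinkProfile α x) := by
  refine intervalIntegral.intervalIntegral_pos_of_pos_on
    ((continuous_riskBudget_shrinkProfile hα).intervalIntegrable _ _) (fun x hx => ?_) one_pos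
  have h0 := shrinkProfile_pos hα hx.1.le hx.2
  have h1 := shrinkProfile_lt_one (α := α) hx.1
  exact div_pos (mul_pos h0 (by linarith)) (by linarith)

theorem integral_shrinkProfile_pos (hα : 0 < α) :
    0 < ∫ x in (0 : ℝ)..1, shrinkProfile α x :=
  intervalIntegral.intervalIntegral_pos_of_pos_on
    ((continuous_shrinkProfile hα).intervalIntegrable _ _)
    (fun _ hx => shrinkProfile_pos hα hx.1.le hx.2) one_pos

theorem integral_log_shrinkProfile_lt (hα : 0 < α) :
    ∫ x in (0 : ℝ)..1, Real.log (1 + shrinkProfile α x) < constK α := by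
  rw [← integral_shrinkProfile hα, ← sub_pos, ← intervalIntegral.integral_sub
    ((continuous_shrinkProfile hα).intervalIntegrable _ _)
    ((continuous_log_shrinkProfile hα).intervalIntegrable _ _)]
  refine intervalIntegral.intervalIntegral_pos_of_pos_on
    (((continuous_shrinkProfile hα).sub (continuous_log_shrinkProfile hα)).intervalIntegrable _ _)
    (fun x hx => ?_) one_pos
  have h0 := shrinkProfile_pos hα hx.1.le hx.2
  have := Real.log_lt_sub_one_of_pos (by linarith : 0 < 1 + shrinkProfile α x) (by linarith)
  linarith

theorem lt_integral_log_shrinkProfile (hα : 0 < α) :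
    constK α / 2 < ∫ x in (0 : ℝ)..1, Real.log (1 + shrinkProfile α x) := by
  rw [← integral_shrinkProfile hα, ← intervalIntegral.integral_div, ← sub_pos,
    ← intervalIntegral.integral_sub ((continuous_log_shrinkProfile hα).intervalIntegrable _ _)
      (((continuous_shrinkProfile hα).div_const 2).intervalIntegrable _ _)]
  refine intervalIntegral.intervalIntegral_pos_of_pos_on (((continuous_log_shrinkProfile hα).sub
    ((continuous_shrinkProfile hα).div_const 2)).intervalIntegrable _ _) (fun x hx => ?_) one_pos
  have h0 := shrinkProfile_pos hα hx.1.le hx.2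
  have h1 := shrinkProfile_lt_one (α := α) hx.1
  have h2 := Real.one_sub_inv_le_log_of_pos (by linarith : 0 < 1 + shrinkProfile α x)
  have h3 : shrinkProfile α x / 2 < 1 - (1 + shrinkProfile α x)⁻¹ := by
    rw [← one_div, lt_sub_iff_add_lt, ← lt_sub_iff_add_lt', div_lt_iff₀ (by linarith)]
    nlinarith
  linarith

/-! ### Riemann sums over the Sobolev frequencies -/

/-- The frequency `2 ⌈(i + 1) / 2⌉` that belongs to the coordinate with index `i`, counted from
zero; its power `α` is the Sobolev weight. -/
def frequency (i : ℕ) : ℕ := 2 * ((i + 1 + 1) / 2)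

theorem sobolevWeight_succ (α : ℝ) (i : ℕ) :
    sobolevWeight α (i + 1) = (frequency i : ℝ) ^ α := rfl

theorem succ_le_frequency (i : ℕ) : (i : ℝ) + 1 ≤ frequency i := by
  have : i + 1 ≤ frequency i := by unfold frequency; omega
  exact_mod_cast this

theorem frequency_le (i : ℕ) : (frequency i : ℝ) ≤ i + 2 := by
  have : frequency i ≤ i + 2 := by unfold frequency; omega
  exact_mod_cast this

theorem frequency_pos (i : ℕ) : (0 : ℝ) < frequency i := by
  linarith [succ_le_frequency i, i.cast_nonneg (α := ℝ)]

/-- The node `frequency i / T` and the interval `[i / T, (i + 1) / T]` lie within `2 / T` of each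
other; the bound `3` on the nodes leaves room for `N = ⌈T⌉` with `1 ≤ T`. -/
theorem abs_sum_div_sub_integral_le {f : ℝ → ℝ} (hf : Continuous f) {T ε : ℝ} (hT : 0 < T)
    (hε : ∀ x ∈ Set.Icc (0 : ℝ) 3, ∀ y ∈ Set.Icc (0 : ℝ) 3, |x - y| ≤ 2 / T → |f x - f y| ≤ ε)
    {N : ℕ} (hN : (N : ℝ) + 1 ≤ 3 * T) :
    |(∑ i ∈ Finset.range N, f (frequency i / T)) / T - ∫ x in (0 : ℝ)..(N / T), f x| ≤
      N * (ε / T) := by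
  have hsplit := intervalIntegral.sum_integral_adjacent_intervals (μ := volume) (f := f)
    (a := fun i : ℕ => (i : ℝ) / T) (n := N) fun k _ => hf.intervalIntegrable _ _
  simp only [Nat.cast_zero, zero_div] at hsplit
  rw [← hsplit, Finset.sum_div, ← Finset.sum_sub_distrib]
  refine (Finset.abs_sum_le_sum_abs _ _).trans ?_
  rw [← nsmul_eq_mul, ← Finset.card_range N, ← Finset.sum_const, Finset.card_range]
  refine Finset.sum_le_sum fun i hi => ?_
  have hiN : (i : ℝ) + 1 ≤ N := by exact_mod_cast Finset.mem_range.1 hi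
  have hi0 : (0 : ℝ) ≤ i := i.cast_nonneg
  have h1 := succ_le_frequency i
  have h2 := frequency_le i
  have hlen : ((i + 1 : ℕ) : ℝ) / T - i / T = 1 / T := by
    push_cast
    ring
  have hconst : f (frequency i / T) / T =
      ∫ _ in ((i : ℝ) / T)..((i + 1 : ℕ) : ℝ) / T, f (frequency i / T) := by
    rw [intervalIntegral.integral_const, hlen, smul_eq_mul]
    ring
  rw [hconst, ← intervalIntegral.integral_sub intervalIntegrable_const (hf.intervalIntegrable _ _),
    ← Real.norm_eq_abs]
  refine (intervalIntegral.norm_integral_le_of_norm_le_const (C := ε) fun x hx => ?_).trans ?_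
  · have hle : (i : ℝ) / T ≤ ((i + 1 : ℕ) : ℝ) / T := by
      gcongr
      simp
    rw [Set.uIoc_of_le hle] at hx
    have hx1 : (i : ℝ) < x * T := (div_lt_iff₀ hT).1 hx.1
    have hx2 : x * T ≤ i + 1 := by simpa using (le_div_iff₀ hT).1 hx.2
    refine hε _ ⟨by positivity, (div_le_iff₀ hT).2 (by linarith)⟩ _
      ⟨by nlinarith, by nlinarith⟩ ?_
    rw [abs_of_nonneg (by rw [sub_nonneg, le_div_iff₀ hT]; linarith), sub_le_iff_le_add,
      div_add' _ _ _ hT.ne']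
    gcongr
    linarith
  · rw [hlen, abs_of_pos (by positivity)]
    exact (mul_one_div ε T).le

/-- Sums over the frequencies are Riemann sums: `frequency i = i + O(1)`, and only about `T` terms
do not vanish. -/
theorem tendsto_sum_frequency {f : ℝ → ℝ} (hf : Continuous f) (hf1 : ∀ x, 1 ≤ x → f x = 0)
    {T : ℕ → ℝ} (hT : Tendsto T atTop atTop) (hTn : ∀ᶠ n : ℕ in atTop, T n + 1 ≤ n) :
    Tendsto (fun n => (∑ i : Fin n, f (frequency i / T n)) / T n) atTop
      (𝓝 (∫ x in (0 : ℝ)..1, f x)) := by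
  have huc := isCompact_Icc.uniformContinuousOn_of_continuous (hf.continuousOn (s := Set.Icc 0 3))
  rw [Metric.uniformContinuousOn_iff] at huc
  rw [Metric.tendsto_atTop']
  intro ε hε
  obtain ⟨d, hd, hfd⟩ := huc (ε / 3) (by positivity)
  have hev : ∀ᶠ n in atTop, 1 ≤ T n ∧ 2 / d < T n ∧ T n + 1 ≤ n :=
    ((hT.eventually_ge_atTop 1).and ((hT.eventually_gt_atTop (2 / d)).and hTn))
  obtain ⟨n₀, hn₀⟩ := eventually_atTop.1 hev
  refine ⟨n₀, fun n hn => ?_⟩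
  obtain ⟨h1, h2, h3⟩ := hn₀ n hn.le
  have hT0 : 0 < T n := by linarith
  set N := ⌈T n⌉₊ with hNdef
  have hN1 : T n ≤ N := Nat.le_ceil _
  have hN2 : (N : ℝ) < T n + 1 := Nat.ceil_lt_add_one hT0.le
  have hNn : N ≤ n := by
    have : (N : ℝ) < n := by linarith
    exact_mod_cast this.le
  have hsum : ∑ i : Fin n, f (frequency i / T n) =
      ∑ i ∈ Finset.range N, f (frequency i / T n) := by
    rw [Fin.sum_univ_eq_sum_range fun i => f (frequency i / T n)]
    symm
    refine Finset.sum_subset (Finset.range_mono hNn) fun i _ hi => hf1 _ ?_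
    have hiN : (N : ℝ) ≤ i := by exact_mod_cast not_lt.1 (fun h => hi (Finset.mem_range.2 h))
    rw [le_div_iff₀ hT0]
    linarith [succ_le_frequency i]
  have hint : ∫ x in (0 : ℝ)..1, f x = ∫ x in (0 : ℝ)..(N / T n), f x := by
    rw [← intervalIntegral.integral_add_adjacent_intervals (b := 1) (hf.intervalIntegrable _ _)
      (hf.intervalIntegrable 1 (N / T n)), left_eq_add]
    have h1N : 1 ≤ N / T n := (one_le_div hT0).2 hN1
    refine (intervalIntegral.integral_congr fun x hx => ?_).trans intervalIntegral.integral_zero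
    rw [Set.uIcc_of_le h1N] at hx
    exact hf1 x hx.1
  rw [Real.dist_eq, hsum, hint]
  refine (abs_sum_div_sub_integral_le hf hT0 (ε := ε / 3) (fun x hx y hy hxy => ?_)
    (by linarith)).trans_lt ?_
  · refine (hfd x hx y hy (hxy.trans_lt ?_)).le
    rwa [div_lt_iff₀ hT0, mul_comm, ← div_lt_iff₀ hd]
  · rw [mul_div_assoc', div_lt_iff₀ hT0]
    nlinarith

/-! ### Asymptotic risk bounds on Sobolev ellipsoids -/

theorem weightProfile_le (hα : 0 < α) {x : ℝ} (hx : 0 < x) : weightProfile α x ≤ x ^ (2 * α) := by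
  refine Real.rpow_le_rpow (le_max_left _ _) ?_ (by linarith)
  exact max_le hx.le (min_le_left _ _)

theorem riskSlope_shrinkProfile (hα : 0 < α) (x : ℝ) :
    riskSlope (shrinkProfile α x) = weightProfile α x :=
  riskSlope_shrinkOf (weightProfile_nonneg x) (weightProfile_le_one hα x)

theorem sq_sobolevWeight_succ (i : ℕ) {T : ℝ} (hT : 0 < T) :
    sobolevWeight α (i + 1) ^ 2 = T ^ (2 * α) * (frequency i / T) ^ (2 * α) := by
  rw [Real.div_rpow (frequency_pos i).le hT.le, mul_div_cancel₀ _ (by positivity),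
    sobolevWeight_succ, mul_comm, Real.rpow_mul (frequency_pos i).le]
  norm_num

theorem sum_le_of_mem_sobolevEllipsoid {C : ℝ} {θ : ℕ → ℝ} (hθ : θ ∈ sobolevEllipsoid C α) {T : ℝ}
    (hT : 0 < T) (n : ℕ) :
    ∑ i : Fin n, (frequency i / T) ^ (2 * α) * (n * firstCoords n θ i ^ 2) ≤
      n / T ^ (2 * α) * C := by
  have hTα : 0 < T ^ (2 * α) := Real.rpow_pos_of_pos hT _
  have h : ∑ i : Fin n, sobolevWeight α (i + 1) ^ 2 * θ i ^ 2 ≤ C := by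
    rw [Fin.sum_univ_eq_sum_range fun i => sobolevWeight α (i + 1) ^ 2 * θ i ^ 2]
    exact (hθ.1.sum_le_tsum _ fun i _ => by positivity).trans hθ.2
  calc ∑ i : Fin n, (frequency i / T) ^ (2 * α) * (n * firstCoords n θ i ^ 2)
      = n / T ^ (2 * α) * ∑ i : Fin n, sobolevWeight α (i + 1) ^ 2 * θ i ^ 2 := by
        rw [Finset.mul_sum]
        refine Finset.sum_congr rfl fun i _ => ?_
        rw [sq_sobolevWeight_succ i hT, firstCoords]
        field_simp
    _ ≤ n / T ^ (2 * α) * C := by gcongr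

theorem exists_mem_sobolevEllipsoid {C : ℝ} {n : ℕ} (hn : n ≠ 0) (θ : Fin n → ℝ) {T : ℝ}
    (hT : 0 < T)
    (h : ∑ i : Fin n, (frequency i / T) ^ (2 * α) * (n * θ i ^ 2) ≤ n / T ^ (2 * α) * C) :
    ∃ θ' ∈ sobolevEllipsoid C α, firstCoords n θ' = θ := by
  have hTα : 0 < T ^ (2 * α) := Real.rpow_pos_of_pos hT _
  have hn0 : (0 : ℝ) < n := by positivity
  set θ' : ℕ → ℝ := fun i => if h : i < n then θ ⟨i, h⟩ else 0 with hθ'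
  have hi : ∀ i : Fin n, θ' i = θ i := fun i => by simp [hθ']
  have hz : ∀ i ∉ Finset.range n, sobolevWeight α (i + 1) ^ 2 * θ' i ^ 2 = 0 := fun i hi => by
    have : ¬ i < n := fun h => hi (Finset.mem_range.2 h)
    simp [hθ', this]
  refine ⟨θ', ⟨summable_of_ne_finset_zero hz, ?_⟩, funext hi⟩
  rw [tsum_eq_sum hz, ← Fin.sum_univ_eq_sum_range fun i => sobolevWeight α (i + 1) ^ 2 * θ' i ^ 2]
  have e : ∑ i : Fin n, (frequency i / T) ^ (2 * α) * (n * θ i ^ 2) =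
      n / T ^ (2 * α) * ∑ i : Fin n, sobolevWeight α (i + 1) ^ 2 * θ' i ^ 2 := by
    rw [Finset.mul_sum]
    refine Finset.sum_congr rfl fun i _ => ?_
    rw [sq_sobolevWeight_succ i hT, hi]
    field_simp
  rw [e] at h
  exact le_of_mul_le_mul_left h (by positivity)

/-- The cut-off frequency of the Gaussian prior at sample size `n`; `ρ` sets its scale. -/
noncomputable def cutoff (α ρ : ℝ) (n : ℕ) : ℝ := (ρ * n) ^ (1 / (2 * α + 1))

theorem cutoff_pos {ρ : ℝ} (hρ : 0 < ρ) {n : ℕ} (hn : n ≠ 0) : 0 < cutoff α ρ n :=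
  Real.rpow_pos_of_pos (by positivity) _

theorem tendsto_cutoff (hα : 0 < α) {ρ : ℝ} (hρ : 0 < ρ) :
    Tendsto (cutoff α ρ) atTop atTop :=
  (tendsto_rpow_atTop (by positivity)).comp
    (tendsto_natCast_atTop_atTop.const_mul_atTop hρ)

/-- The cut-off solves `T ^ (2 α + 1) = ρ n`. -/
theorem div_rpow_cutoff (hα : 0 < α) {ρ : ℝ} (hρ : 0 < ρ) {n : ℕ} (hn : n ≠ 0) :
    n / cutoff α ρ n ^ (2 * α) = cutoff α ρ n / ρ := by
  have hT := cutoff_pos (α := α) hρ hn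
  have h : cutoff α ρ n ^ (2 * α) * cutoff α ρ n = ρ * n := by
    nth_rw 2 [← Real.rpow_one (cutoff α ρ n)]
    rw [← Real.rpow_add hT, cutoff, ← Real.rpow_mul (by positivity),
      one_div_mul_cancel (by positivity), Real.rpow_one]
  rw [div_eq_div_iff (by positivity) hρ.ne']
  linarith

theorem rpow_eq_natCast_mul_div_cutoff (hα : 0 < α) {ρ : ℝ} (hρ : 0 < ρ) {n : ℕ} (hn : n ≠ 0) :
    (n : ℝ) ^ (2 * α / (2 * α + 1)) = n * (ρ ^ (1 / (2 * α + 1)) / cutoff α ρ n) := by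
  have hn0 : (0 : ℝ) < n := by positivity
  have hρ' : ρ ^ (1 / (2 * α + 1)) ≠ 0 := by positivity
  have h : (2 * α / (2 * α + 1)) = 1 - 1 / (2 * α + 1) := by field_simp; ring
  rw [cutoff, Real.mul_rpow hρ.le hn0.le, h, Real.rpow_sub hn0, Real.rpow_one]
  field_simp

theorem eventually_cutoff_add_one_le (hα : 0 < α) {ρ : ℝ} (hρ : 0 < ρ) :
    ∀ᶠ n : ℕ in atTop, cutoff α ρ n + 1 ≤ n := by
  have hγ : 0 < 2 * α / (2 * α + 1) := by positivity
  have h := ((tendsto_rpow_atTop hγ).comp tendsto_natCast_atTop_atTop).eventually_ge_atTop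
    (2 * ρ ^ (1 / (2 * α + 1)))
  filter_upwards [h, eventually_ge_atTop 2] with n hn hn2
  have hn0 : n ≠ 0 := by omega
  have hn2' : (2 : ℝ) ≤ n := by exact_mod_cast hn2
  have hT := cutoff_pos (α := α) hρ hn0
  have hr : 0 < ρ ^ (1 / (2 * α + 1)) := by positivity
  simp only [Function.comp_apply] at hn
  rw [rpow_eq_natCast_mul_div_cutoff hα hρ hn0, mul_div_assoc', le_div_iff₀ hT] at hn
  have : 2 * cutoff α ρ n ≤ n := le_of_mul_le_mul_left (by linarith) hr
  linarith

theorem ofReal_rpow_mul (hα : 0 < α) {ρ : ℝ} (hρ : 0 < ρ) {n : ℕ} (hn : n ≠ 0) (R : ℝ≥0∞) :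
    ENNReal.ofReal ((n : ℝ) ^ (2 * α / (2 * α + 1))) * R =
      ENNReal.ofReal (ρ ^ (1 / (2 * α + 1)) / cutoff α ρ n) * (n * R) := by
  rw [rpow_eq_natCast_mul_div_cutoff hα hρ hn, mul_comm (n : ℝ), ENNReal.ofReal_mul
    (div_nonneg (by positivity) (cutoff_pos hρ hn).le), ENNReal.ofReal_natCast, mul_assoc]

/-- The value `∑ f (w i) / T` over the shrinkage factors `w i` of the prior with cut-off `T`. -/
noncomputable def profileSum (α : ℝ) (f : ℝ → ℝ) (T : ℝ) (n : ℕ) : ℝ :=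
  (∑ i : Fin n, f (shrinkProfile α (frequency i / T))) / T

theorem tendsto_profileSum (hα : 0 < α) {ρ : ℝ} (hρ : 0 < ρ) {f : ℝ → ℝ}
    (hf : Continuous fun x => f (shrinkProfile α x)) (hf0 : f 0 = 0) :
    Tendsto (fun n => profileSum α f (cutoff α ρ n) n) atTop
      (𝓝 (∫ x in (0 : ℝ)..1, f (shrinkProfile α x))) :=
  tendsto_sum_frequency hf (fun x hx => by rw [shrinkProfile_of_one_le hx, hf0])
    (tendsto_cutoff hα hρ) (eventually_cutoff_add_one_le hα hρ)

theorem linearMinimaxRisk_sobolevEllipsoid_le (hα : 0 < α) (C : ℝ) {ρ : ℝ} (hρ : 0 < ρ) {n : ℕ}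
    (hn : n ≠ 0) :
    ENNReal.ofReal ((n : ℝ) ^ (2 * α / (2 * α + 1))) *
        linearMinimaxRisk n n (sobolevEllipsoid C α) ≤
      ENNReal.ofReal (ρ ^ (1 / (2 * α + 1)) * (1 / 2 *
        (profileSum α (fun w => Real.log (1 + w)) (cutoff α ρ n) n -
          profileSum α riskBudget (cutoff α ρ n) n + C / ρ))) := by
  have hT := cutoff_pos (α := α) hρ hn
  set T := cutoff α ρ n with hTdef
  have hx : ∀ i : ℕ, 0 < frequency i / T := fun i => div_pos (frequency_pos i) hT
  have h := linearMinimaxRisk_le hn (w := fun i => shrinkProfile α (frequency i / T))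
    (Y := fun i => (frequency i / T) ^ (2 * α)) (fun i => shrinkProfile_nonneg hα _)
    (fun i => shrinkProfile_lt_one (hx i))
    (fun i => (riskSlope_shrinkProfile hα _).trans_le (weightProfile_le hα (hx i)))
    (Θ := sobolevEllipsoid C α) (fun θ hθ => sum_le_of_mem_sobolevEllipsoid hθ hT n)
  rw [ofReal_rpow_mul hα hρ hn]
  refine (mul_le_mul_right h _).trans_eq ?_
  rw [← ENNReal.ofReal_mul (div_nonneg (by positivity) hT.le), div_rpow_cutoff hα hρ hn, ← hTdef]
  congr 1
  simp only [profileSum]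
  field_simp

/-- The lower bound behind the limit: `T * d` is the distance between the ellipsoid's bound and the
prior mean of the quadratic form. -/
theorem le_minimaxRisk_sobolevEllipsoid (hα : 0 < α) {C : ℝ} {ρ : ℝ} (hρ : 0 < ρ) {κ : ℝ}
    (hκ : ∀ s : ℝ≥0, ∫ z, z ^ 4 ∂gaussianReal 0 s = κ * (s : ℝ) ^ 2) {n : ℕ} (hn : n ≠ 0) {d : ℝ}
    (hd : 0 < d) (hdC : d = C / ρ - profileSum α riskBudget (cutoff α ρ n) n) :
    ENNReal.ofReal (ρ ^ (1 / (2 * α + 1)) *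
      (1 / 2 * profileSum α (fun w => Real.log (1 + w)) (cutoff α ρ n) n -
        (1 / 2 * ((profileSum α (fun w => Real.log (1 + w)) (cutoff α ρ n) n +
          profileSum α riskBudget (cutoff α ρ n) n) / d ^ 2 + 1 / d) *
          (κ * profileSum α (fun w => riskBudget w ^ 2) (cutoff α ρ n) n) + 1) *
          (cutoff α ρ n)⁻¹)) ≤
      ENNReal.ofReal ((n : ℝ) ^ (2 * α / (2 * α + 1))) *
        minimaxRisk n n (sobolevEllipsoid C α) := by
  have hT := cutoff_pos (α := α) hρ hn
  have hb := div_rpow_cutoff hα hρ hn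
  set T := cutoff α ρ n with hTdef
  have hx : ∀ i : ℕ, 0 < frequency i / T := fun i => div_pos (frequency_pos i) hT
  have hbT : ∑ i : Fin n, riskBudget (shrinkProfile α (frequency i / T)) + T * d =
      n / T ^ (2 * α) * C := by
    rw [hb, hdC, profileSum]
    field_simp
    ring
  have h := le_minimaxRisk hn (w := fun i => shrinkProfile α (frequency i / T))
    (Y := fun i => (frequency i / T) ^ (2 * α)) (fun i => shrinkProfile_nonneg hα _)
    (fun i => shrinkProfile_lt_one (hx i))
    (fun i => (riskSlope_shrinkProfile hα _).trans_le (weightProfile_le hα (hx i)))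
    (fun i hi => by
      rw [riskSlope_shrinkProfile hα, weightProfile_of_mem (hx i).le]
      by_contra hgt
      exact hi (shrinkProfile_of_one_le (not_le.1 hgt).le)) hκ (mul_pos hT hd)
    (Θ := sobolevEllipsoid C α)
    (fun θ hθ => exists_mem_sobolevEllipsoid hn θ hT (hθ.trans_eq hbT))
  rw [← tsub_le_iff_right, ← ENNReal.ofReal_one, ← ENNReal.ofReal_sub _ zero_le_one] at h
  rw [ofReal_rpow_mul hα hρ hn]
  refine Eq.trans_le ?_ (mul_le_mul_right h _)
  rw [← ENNReal.ofReal_mul (div_nonneg (by positivity) hT.le)]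
  congr 1
  simp only [profileSum]
  field_simp
  ring

/-- The lower bound of `le_minimaxRisk_sobolevEllipsoid` as `n → ∞`: the terms other than the Bayes
risk are bounded and are divided by the cut-off. -/
theorem tendsto_lower_bound (hα : 0 < α) {ρ : ℝ} (hρ : 0 < ρ) (C κ : ℝ)
    (hd : C / ρ - ∫ x in (0 : ℝ)..1, riskBudget (shrinkProfile α x) ≠ 0) :
    Tendsto (fun n => ρ ^ (1 / (2 * α + 1)) *
      (1 / 2 * profileSum α (fun w => Real.log (1 + w)) (cutoff α ρ n) n -
        (1 / 2 * ((profileSum α (fun w => Real.log (1 + w)) (cutoff α ρ n) n +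
          profileSum α riskBudget (cutoff α ρ n) n) /
            (C / ρ - profileSum α riskBudget (cutoff α ρ n) n) ^ 2 +
              1 / (C / ρ - profileSum α riskBudget (cutoff α ρ n) n)) *
          (κ * profileSum α (fun w => riskBudget w ^ 2) (cutoff α ρ n) n) + 1) *
          (cutoff α ρ n)⁻¹)) atTop
      (𝓝 (ρ ^ (1 / (2 * α + 1)) *
        (1 / 2 * ∫ x in (0 : ℝ)..1, Real.log (1 + shrinkProfile α x)))) := by
  have hG := tendsto_profileSum hα hρ (f := fun w => Real.log (1 + w))
    (continuous_log_shrinkProfile hα) (by simp)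
  have hB := tendsto_profileSum hα hρ (f := riskBudget)
    (continuous_riskBudget_shrinkProfile hα) (by simp [riskBudget])
  have hB2 := tendsto_profileSum hα hρ (f := fun w => riskBudget w ^ 2)
    ((continuous_riskBudget_shrinkProfile hα).pow 2) (by simp [riskBudget])
  have hT := (tendsto_cutoff hα hρ).inv_tendsto_atTop
  have hD := hB.const_sub (C / ρ)
  have hD1 := (tendsto_const_nhds (x := (1 : ℝ))).div hD hd
  have hE := ((((hG.add hB).div (hD.pow 2) (pow_ne_zero 2 hd)).add hD1).const_mul (1 / 2)).mul
    (hB2.const_mul κ)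
  have h := ((hG.const_mul (1 / 2)).sub ((hE.add_const 1).mul hT)).const_mul
    (ρ ^ (1 / (2 * α + 1)))
  rw [mul_zero, sub_zero] at h
  exact h

/-! ### The limit of the minimax risks -/

/-- The common limit of the normalized risks, before its constants are evaluated. -/
noncomputable def limitRisk (C α : ℝ) : ℝ :=
  (C / ∫ x in (0 : ℝ)..1, riskBudget (shrinkProfile α x)) ^ (1 / (2 * α + 1)) *
    (1 / 2 * ∫ x in (0 : ℝ)..1, Real.log (1 + shrinkProfile α x))

/-- With `ρ = C / H`, where `H` is the budget integral, the budget of the prior is asymptotically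
equal to the bound of the ellipsoid, and the two cancel in the upper bound. -/
theorem eventually_linearMinimaxRisk_lt {C : ℝ} (hC : 0 < C) (hα : 0 < α) {a : ℝ≥0∞}
    (ha : ENNReal.ofReal (limitRisk C α) < a) :
    ∀ᶠ n : ℕ in atTop, ENNReal.ofReal ((n : ℝ) ^ (2 * α / (2 * α + 1))) *
      linearMinimaxRisk n n (sobolevEllipsoid C α) < a := by
  have hH := integral_riskBudget_shrinkProfile_pos hα
  set H := ∫ x in (0 : ℝ)..1, riskBudget (shrinkProfile α x) with hHdef
  have hρ : 0 < C / H := by positivity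
  have hG := tendsto_profileSum hα hρ (f := fun w => Real.log (1 + w))
    (continuous_log_shrinkProfile hα) (by simp)
  have hB := tendsto_profileSum hα hρ (f := riskBudget)
    (continuous_riskBudget_shrinkProfile hα) (by simp [riskBudget])
  have h := (((hG.sub hB).add_const (C / (C / H))).const_mul (1 / 2)).const_mul
    ((C / H) ^ (1 / (2 * α + 1)))
  rw [← hHdef, div_div_cancel₀ hC.ne', sub_add_cancel] at h
  have h' := (ENNReal.tendsto_ofReal h).eventually_lt_const ha
  filter_upwards [h', eventually_ne_atTop 0] with n hn hn0
  refine (linearMinimaxRisk_sobolevEllipsoid_le hα C hρ hn0).trans_lt ?_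
  rwa [div_div_cancel₀ hC.ne']

theorem eventually_lt_minimaxRisk {C : ℝ} (hC : 0 < C) (hα : 0 < α) {a : ℝ≥0∞}
    (ha : a < ENNReal.ofReal (limitRisk C α)) :
    ∀ᶠ n : ℕ in atTop, a < ENNReal.ofReal ((n : ℝ) ^ (2 * α / (2 * α + 1))) *
      minimaxRisk n n (sobolevEllipsoid C α) := by
  have hH := integral_riskBudget_shrinkProfile_pos hα
  obtain ⟨κ, hκ⟩ := exists_integral_pow_four_gaussianReal
  set H := ∫ x in (0 : ℝ)..1, riskBudget (shrinkProfile α x) with hHdef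
  set I := 1 / 2 * ∫ x in (0 : ℝ)..1, Real.log (1 + shrinkProfile α x) with hI
  -- A prior whose mean budget tends to `r C`, `r < 1`, loses only the factor `r ^ (1 / (2α + 1))`.
  have hcont : Tendsto (fun r : ℝ => ENNReal.ofReal ((r * C / H) ^ (1 / (2 * α + 1)) * I))
      (𝓝[<] 1) (𝓝 (ENNReal.ofReal (limitRisk C α))) := by
    have hc : Continuous fun r : ℝ => (r * C / H) ^ (1 / (2 * α + 1)) * I :=
      (Continuous.rpow_const (by fun_prop) fun _ => Or.inr (by positivity)).mul_const I
    have := (ENNReal.tendsto_ofReal (hc.tendsto 1)).mono_left (nhdsWithin_le_nhds (s := Set.Iio 1))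
    rwa [one_mul] at this
  obtain ⟨r, har, hr0, hr1⟩ := ((hcont.eventually_const_lt ha).and
    (Ioo_mem_nhdsLT (zero_lt_one (α := ℝ)))).exists
  have hρ : 0 < r * C / H := by positivity
  have hCρ : C / (r * C / H) = H / r := by field_simp
  have hd : 0 < C / (r * C / H) - H := by
    rw [hCρ, sub_pos, lt_div_iff₀ hr0]
    nlinarith
  have h := (ENNReal.tendsto_ofReal (tendsto_lower_bound hα hρ C κ hd.ne')).eventually_const_lt har
  have hB := tendsto_profileSum hα hρ (f := riskBudget)
    (continuous_riskBudget_shrinkProfile hα) (by simp [riskBudget])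
  have hdn := (hB.const_sub (C / (r * C / H))).eventually_const_lt hd
  filter_upwards [h, hdn, eventually_ne_atTop 0] with n hn hn2 hn0
  exact hn.trans_le (le_minimaxRisk_sobolevEllipsoid hα hρ hκ hn0 hn2 rfl)

end KLPrediction

/-- The limits are taken in `[0, ∞]`, towards the finite positive value `L`. The first three
conjuncts say that the constants `K` and `M` are well defined and positive. -/
theorem mainTheorem6 (C α : ℝ) (hC : 0 < C) (hα : 0 < α) :
    Summable (KLPrediction.seriesTerm α) ∧
    0 < (∑' k, KLPrediction.seriesTerm α k) - 3 / (2 * α + 1) ∧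
    0 < KLPrediction.constK α ∧
    ∃ L : ℝ, 0 < L ∧
      L ∈ Set.Ioo (1 / 4 * (KLPrediction.constK α * KLPrediction.constM C α))
        (1 / 2 * (KLPrediction.constK α * KLPrediction.constM C α)) ∧
      Tendsto (fun n : ℕ => ENNReal.ofReal ((n : ℝ) ^ (2 * α / (2 * α + 1))) *
          KLPrediction.minimaxRisk n n (KLPrediction.sobolevEllipsoid C α))
        atTop (𝓝 (ENNReal.ofReal L)) ∧
      Tendsto (fun n : ℕ => ENNReal.ofReal ((n : ℝ) ^ (2 * α / (2 * α + 1))) *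
          KLPrediction.linearMinimaxRisk n n (KLPrediction.sobolevEllipsoid C α))
        atTop (𝓝 (ENNReal.ofReal L)) := by
  have hH := KLPrediction.integral_riskBudget_shrinkProfile_pos hα
  have hHeq := KLPrediction.integral_riskBudget_shrinkProfile hα
  have hK : 0 < KLPrediction.constK α := by
    rw [← KLPrediction.integral_shrinkProfile hα]
    exact KLPrediction.integral_shrinkProfile_pos hα
  have hM : KLPrediction.constM C α =
      (C / ∫ x in (0 : ℝ)..1, KLPrediction.riskBudget (KLPrediction.shrinkProfile α x)) ^
        (1 / (2 * α + 1)) := by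
    rw [KLPrediction.constM, hHeq, div_div_eq_mul_div, mul_comm C]
  have hM0 : 0 < KLPrediction.constM C α := by
    rw [hM]
    positivity
  have hlo := KLPrediction.lt_integral_log_shrinkProfile hα
  have hhi := KLPrediction.integral_log_shrinkProfile_lt hα
  have hle : ∀ᶠ n : ℕ in atTop, ENNReal.ofReal ((n : ℝ) ^ (2 * α / (2 * α + 1))) *
      KLPrediction.minimaxRisk n n (KLPrediction.sobolevEllipsoid C α) ≤
        ENNReal.ofReal ((n : ℝ) ^ (2 * α / (2 * α + 1))) *
          KLPrediction.linearMinimaxRisk n n (KLPrediction.sobolevEllipsoid C α) := by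
    filter_upwards [eventually_ne_atTop 0] with n hn
    exact mul_le_mul_right (KLPrediction.minimaxRisk_le_linearMinimaxRisk hn _) _
  have hL : KLPrediction.limitRisk C α = KLPrediction.constM C α *
      (1 / 2 * ∫ x in (0 : ℝ)..1, Real.log (1 + KLPrediction.shrinkProfile α x)) := by
    rw [hM, KLPrediction.limitRisk]
  refine ⟨(KLPrediction.hasSum_seriesTerm hα).summable, by linarith, hK,
    KLPrediction.limitRisk C α, ?_, ⟨?_, ?_⟩, tendsto_order.2 ⟨fun a ha => ?_, fun a ha => ?_⟩,
    tendsto_order.2 ⟨fun a ha => ?_, fun a ha => ?_⟩⟩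
  · rw [hL]
    exact mul_pos hM0 (by linarith)
  · rw [hL]
    nlinarith
  · rw [hL]
    nlinarith
  · exact KLPrediction.eventually_lt_minimaxRisk hC hα ha
  · filter_upwards [hle, KLPrediction.eventually_linearMinimaxRisk_lt hC hα ha] with n h1 h2
    exact h1.trans_lt h2
  · filter_upwards [hle, KLPrediction.eventually_lt_minimaxRisk hC hα ha] with n h1 h2
    exact h2.trans_le h1
  · exact KLPrediction.eventually_linearMinimaxRisk_lt hC hα ha
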